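/- For $\alpha,\beta>-1$ and $n\in\mathbb{N}=\{0,1,2,\ldots\}$ let $P_n^{(\alpha,\beta)}$ be the Jacobi polynomial, given for $-1<z<1$ by Rodrigues' formula \[ (1-z)^{\alpha}(1+z)^{\beta}P_n^{(\alpha,\beta)}(z)=\frac{(-1)^n}{2^n\,n!}\frac{d^n}{dz^n}\left((1-z)^{\alpha+n}(1+z)^{\beta+n}\right), \] and for $0<x<\pi$ let \[ p_n^{(\alpha,\beta)}(x)=w_n^{(\alpha,\beta)}\Big(\sin\frac{x}{2}\Big)^{\alpha+1/2}\Big(\cos\frac{x}{2}\Big)^{\beta+1/2}P_n^{(\alpha,\beta)}(\cos x), \] where \[ w_n^{(\alpha,\beta)}=\sqrt{\frac{(2n+\alpha+\beta+1)\,\Gamma(n+1)\,\Gamma(n+\alpha+\beta+1)}{\Gamma(n+\alpha+1)\,\Gamma(n+\beta+1)}}\quad(n\ge 1),\qquad w_0^{(\alpha,\beta)}=\sqrt{\frac{\Gamma(\alpha+\beta+2)}{\Gamma(\alpha+1)\Gamma(\beta+1)}}. \] Define the transplantation kernel \[ K_{\alpha,\beta}^{\gamma,\delta}(n,m)=\int_0^\pi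 p_n^{(\gamma,\delta)}(x)\,p_m^{(\alpha,\beta)}(x)\,dx,\qquad n,m\in\mathbb{N}. \] **Proposition.** Let $\alpha,\beta,\gamma,\delta\ge -1/2$ with $\alpha\ne\gamma$ and $\beta\ne\delta$. There is a constant $C>0$, depending only on $\alpha,\beta,\gamma,\delta$, such that for all $n,m\in\mathbb{N}$ with $n\ne m$ and $m/2\le n\le 2m$, \[ \left|K_{\alpha,\beta}^{\gamma,\delta}(n+2,m)-K_{\alpha,\beta}^{\gamma,\delta}(n,m)\right|\le\frac{C}{|n-m|^2} \quad\text{and}\quad \left|K_{\alpha,\beta}^{\gamma,\delta}(n,m)-K_{\alpha,\beta}^{\gamma,\delta}(n,m+2)\right|\le\frac{C}{|n-m|^2}. \] -/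

import Mathlib

noncomputable section

/-- The Jacobi polynomial `P_n^{(α,β)}(z)` through Rodrigues' formula
`(1-z)^α (1+z)^β P_n^{(α,β)}(z) = (-1)^n / (2^n n!) (d/dz)^n ((1-z)^(α+n) (1+z)^(β+n))`.
It is only used for `-1 < z < 1`, where both bases are positive. -/
def jacobiP (α β : ℝ) (n : ℕ) (z : ℝ) : ℝ :=
  (1 - z) ^ (-α) * (1 + z) ^ (-β) *
    ((-1 : ℝ) ^ n / ((2 : ℝ) ^ n * (Nat.factorial n : ℝ)) *
      iteratedDeriv n (fun t : ℝ => (1 - t) ^ (α + n) * (1 + t) ^ (β + n)) z)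

/-- The normalization factor `w_n^{(α,β)}`, with its separate value at `n = 0`. -/
def jacobiW (α β : ℝ) (n : ℕ) : ℝ :=
  if n = 0 then
    Real.sqrt (Real.Gamma (α + β + 2) / (Real.Gamma (α + 1) * Real.Gamma (β + 1)))
  else
    Real.sqrt ((2 * n + α + β + 1) * Real.Gamma (n + 1) * Real.Gamma (n + α + β + 1) /
      (Real.Gamma (n + α + 1) * Real.Gamma (n + β + 1)))

/-- The orthonormal Jacobi system on `(0, π)`:
`p_n^{(α,β)}(x) = w_n (sin (x/2))^(α+1/2) (cos (x/2))^(β+1/2) P_n^{(α,β)}(cos x)`. -/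
def jacobiFun (α β : ℝ) (n : ℕ) (x : ℝ) : ℝ :=
  jacobiW α β n * Real.sin (x / 2) ^ (α + 1 / 2) * Real.cos (x / 2) ^ (β + 1 / 2) *
    jacobiP α β n (Real.cos x)

/-- The transplantation kernel
`K_{α,β}^{γ,δ}(n,m) = ∫_0^π p_n^{(γ,δ)}(x) p_m^{(α,β)}(x) dx`. -/
def transplantationKernel (α β γ δ : ℝ) (n m : ℕ) : ℝ :=
  ∫ x in Set.Ioo (0 : ℝ) Real.pi, jacobiFun γ δ n x * jacobiFun α β m x

end

open Real Set Filter Topology intervalIntegral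

/-! Write u_n for the functions with parameters (γ,δ) and v_m for those with (α,β). The half-angle
weights put Jacobi's equation in Liouville normal form: u'' = (V - N²)u and v'' = (W - M²)v on
(0,π), where N = n + (γ+δ+1)/2, M = m + (α+β+1)/2, and V, W are O(1/sin²).

The first point is that the difference of two functions is nearly a derivative. Adding the raising
and lowering relations at one index cancels the cosine terms and gives u_{n+1} - u_{n-1} = (2/N)
sin·u_n' + O(n⁻²), because the off-diagonal recurrence coefficients are 1 + O(n⁻²) and the diagonal
ones are O(1/n) (`abs_jacobiU_sub_sub_le`). So a kernel difference is (2/N)∫ sin·u'v up to O(n⁻²),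
and it suffices to show ∫ sin·u'v = O(R/d²), where R is of the order of the frequencies and d = |n -
m| (`IsOscillating.abs_integral_sin_deriv_mul`).

The second point is that this integral oscillates. Within 1/R of the endpoints the integrand is
bounded, which costs O(1/R). In between, 2 sin·u'v = (sin·uv)' - cos·uv - sin·(uv' - u'v). Put Δ =
N² - M², which is of order at least Rd. The derivative of the Wronskian uv' - u'v is Δ·uv up to
potential terms, so ∫ cos·uv = O(R/Δ). The derivative of the mixed energy u'v' + (N²+M²)/2·uv is
-Δ/2 times the Wronskian, again up to potential terms, so each integration by parts gains a factor
Δ. The result is O(1/R + R/Δ + R³/Δ²) = O(R/d²).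

All this needs |u_n| = O(1) and |u_n'| = O(n + 1/sin x) uniformly in n (`exists_jacobiU_bound`). The
symmetric three-term recurrence makes the L² norm constant for n ≥ 2. The energy u'² + N²u² is
comparable at any two points at distance at least const/N from the ends, and over the middle half of
(0,π) its average is controlled by the L² norms. Nearer the ends, the polynomial factor is almost
constant. -/

/-! ### Rodrigues' formula and the raising relation. -/

theorem hasDerivAt_iteratedDeriv_of_contDiffAt {f : ℝ → ℝ} {z : ℝ}
    (hf : ContDiffAt ℝ (⊤ : ℕ∞) f z) (k : ℕ) :
    HasDerivAt (iteratedDeriv k f) (iteratedDeriv (k + 1) f z) z := by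
  rw [iteratedDeriv_succ]
  refine DifferentiableAt.hasDerivAt ?_
  rw [iteratedDeriv_eq_equiv_comp]
  refine (LinearIsometryEquiv.differentiable _).differentiableAt.comp z ?_
  exact hf.differentiableAt_iteratedFDeriv (by exact_mod_cast ENat.natCast_lt_top k)

/-- In Leibniz' rule only two terms survive when one factor is linear. Stating it at order n + 1
avoids a subtraction in the index. -/
theorem iteratedDeriv_succ_linear_mul {f : ℝ → ℝ} {U : Set ℝ} (hU : IsOpen U)
    (hf : ∀ z ∈ U, ContDiffAt ℝ (⊤ : ℕ∞) f z) (p q : ℝ) (n : ℕ) :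
    ∀ z ∈ U, iteratedDeriv (n + 1) (fun t => (p + q * t) * f t) z =
      (p + q * z) * iteratedDeriv (n + 1) f z + (n + 1) * q * iteratedDeriv n f z := by
  have hd : ∀ k : ℕ, ∀ z ∈ U,
      HasDerivAt (iteratedDeriv k f) (iteratedDeriv (k + 1) f z) z :=
    fun k z hz => hasDerivAt_iteratedDeriv_of_contDiffAt (hf z hz) k
  have hl : ∀ z : ℝ, HasDerivAt (fun t : ℝ => p + q * t) q z := by
    intro z
    simpa using ((hasDerivAt_id z).const_mul q).const_add p
  induction n with
  | zero =>
    intro z hz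
    have h := (hl z).mul (hd 0 z hz)
    simp only [iteratedDeriv_zero] at h
    rw [iteratedDeriv_succ, iteratedDeriv_zero]
    refine h.deriv.trans ?_
    simp only [iteratedDeriv_zero]
    push_cast
    ring
  | succ k ih =>
    intro z hz
    rw [iteratedDeriv_succ]
    have he : iteratedDeriv (k + 1) (fun t => (p + q * t) * f t) =ᶠ[𝓝 z]
        fun z => (p + q * z) * iteratedDeriv (k + 1) f z + (k + 1) * q * iteratedDeriv k f z := by
      filter_upwards [hU.mem_nhds hz] with y hy using ih y hy
    rw [he.deriv_eq]
    have h := ((hl z).mul (hd (k + 1) z hz)).add ((hd k z hz).const_mul ((k + 1) * q))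
    refine h.deriv.trans ?_
    push_cast
    ring

/-- The weight `(1 - t)^a (1 + t)^b`. -/
noncomputable def jacobiWeight (a b t : ℝ) : ℝ := (1 - t) ^ a * (1 + t) ^ b

theorem jacobiWeight_contDiffAt (a b : ℝ) {z : ℝ} (hz : z ∈ Ioo (-1 : ℝ) 1) :
    ContDiffAt ℝ (⊤ : ℕ∞) (jacobiWeight a b) z := by
  have h1 : (1 : ℝ) - z ≠ 0 := by linarith [hz.2] |> fun h : 0 < 1 - z => h.ne'
  have h2 : (1 : ℝ) + z ≠ 0 := by linarith [hz.1] |> fun h : 0 < 1 + z => h.ne'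
  unfold jacobiWeight
  exact ((contDiffAt_const.sub contDiffAt_id).rpow_const_of_ne h1).mul
    ((contDiffAt_const.add contDiffAt_id).rpow_const_of_ne h2)

theorem jacobiWeight_succ (a b : ℝ) {z : ℝ} (hz : z ∈ Ioo (-1 : ℝ) 1) :
    jacobiWeight (a + 1) (b + 1) z = (1 - z) * ((1 + z) * jacobiWeight a b z) := by
  have h1 : (1 : ℝ) - z ≠ 0 := by linarith [hz.2] |> fun h : 0 < 1 - z => h.ne'
  have h2 : (1 : ℝ) + z ≠ 0 := by linarith [hz.1] |> fun h : 0 < 1 + z => h.ne'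
  unfold jacobiWeight
  rw [rpow_add_one h1, rpow_add_one h2]
  ring

theorem jacobiWeight_hasDerivAt (a b : ℝ) {z : ℝ} (hz : z ∈ Ioo (-1 : ℝ) 1) :
    HasDerivAt (jacobiWeight (a + 1) (b + 1))
      ((b - a + (-(a + b + 2)) * z) * jacobiWeight a b z) z := by
  have h1 : (1 : ℝ) - z ≠ 0 := by linarith [hz.2] |> fun h : 0 < 1 - z => h.ne'
  have h2 : (1 : ℝ) + z ≠ 0 := by linarith [hz.1] |> fun h : 0 < 1 + z => h.ne'
  have e1 : HasDerivAt (fun t : ℝ => (1 - t) ^ (a + 1)) (-(a + 1) * (1 - z) ^ a) z := by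
    have h := ((hasDerivAt_id z).const_sub 1).rpow_const (p := a + 1) (Or.inl h1)
    simp only [id, add_sub_cancel_right] at h
    exact h.congr_deriv (by ring)
  have e2 : HasDerivAt (fun t : ℝ => (1 + t) ^ (b + 1)) ((b + 1) * (1 + z) ^ b) z := by
    have h := ((hasDerivAt_id z).const_add 1).rpow_const (p := b + 1) (Or.inl h2)
    simp only [id, add_sub_cancel_right] at h
    exact h.congr_deriv (by ring)
  refine (e1.mul e2).congr_deriv ?_
  unfold jacobiWeight
  rw [rpow_add_one h1, rpow_add_one h2]
  ring

/-- The `n`-th derivative in Rodrigues' formula. -/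
noncomputable def rodriguesDeriv (α β : ℝ) (n : ℕ) (z : ℝ) : ℝ :=
  iteratedDeriv n (jacobiWeight (α + n) (β + n)) z

theorem rodriguesDeriv_hasDerivAt (α β : ℝ) (n : ℕ) {z : ℝ} (hz : z ∈ Ioo (-1 : ℝ) 1) :
    HasDerivAt (rodriguesDeriv α β n)
      (iteratedDeriv (n + 1) (jacobiWeight (α + n) (β + n)) z) z :=
  hasDerivAt_iteratedDeriv_of_contDiffAt (jacobiWeight_contDiffAt _ _ hz) n

theorem rodriguesDeriv_one (α β : ℝ) {z : ℝ} (hz : z ∈ Ioo (-1 : ℝ) 1) :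
    rodriguesDeriv α β 1 z = (β - α - (α + β + 2) * z) * jacobiWeight α β z := by
  unfold rodriguesDeriv
  rw [iteratedDeriv_one]
  push_cast
  rw [(jacobiWeight_hasDerivAt α β hz).deriv]
  ring

/-- The weight of level k + 2 is (1 - t)(1 + t)f, with f the weight of level k + 1. Its derivative
of order k + 2 is computed twice: by Leibniz on the two linear factors (`h1`), and by
differentiating once first, which leaves a linear multiple of f (`h2`). Eliminating the derivative
of f of order k gives the relation. -/
theorem rodriguesDeriv_raising (α β : ℝ) (k : ℕ) {z : ℝ} (hz : z ∈ Ioo (-1 : ℝ) 1) :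
    (α + β + 2 * k + 4) * ((1 - z ^ 2) * deriv (rodriguesDeriv α β (k + 1)) z) =
      (k + 2) * (β - α + (α + β + 2 * k + 4) * z) * rodriguesDeriv α β (k + 1) z +
      (k + 2 + α + β) * rodriguesDeriv α β (k + 2) z := by
  set f := jacobiWeight (α + (k + 1 : ℕ)) (β + (k + 1 : ℕ)) with hf
  have hU : IsOpen (Ioo (-1 : ℝ) 1) := isOpen_Ioo
  have hfs : ∀ y ∈ Ioo (-1 : ℝ) 1, ContDiffAt ℝ (⊤ : ℕ∞) f y :=
    fun y hy => jacobiWeight_contDiffAt _ _ hy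
  have hgs : ∀ y ∈ Ioo (-1 : ℝ) 1, ContDiffAt ℝ (⊤ : ℕ∞) (fun t => (1 + 1 * t) * f t) y := by
    intro y hy
    exact (contDiffAt_const.add (contDiffAt_const.mul contDiffAt_id)).mul (hfs y hy)
  have ec : α + ((k + 2 : ℕ) : ℝ) = (α + (k + 1 : ℕ)) + 1 := by push_cast; ring
  have ed : β + ((k + 2 : ℕ) : ℝ) = (β + (k + 1 : ℕ)) + 1 := by push_cast; ring
  have h1 : rodriguesDeriv α β (k + 2) z =
      iteratedDeriv (k + 2) (fun t => (1 + (-1) * t) * ((1 + 1 * t) * f t)) z := by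
    unfold rodriguesDeriv
    refine Filter.EventuallyEq.iteratedDeriv_eq _ ?_
    filter_upwards [hU.mem_nhds hz] with y hy
    rw [ec, ed, jacobiWeight_succ _ _ hy]
    ring
  have h2 : rodriguesDeriv α β (k + 2) z = iteratedDeriv (k + 1) (fun t =>
      (β - α + (-(α + β + 2 * k + 4)) * t) * f t) z := by
    unfold rodriguesDeriv
    rw [iteratedDeriv_succ']
    refine Filter.EventuallyEq.iteratedDeriv_eq _ ?_
    filter_upwards [hU.mem_nhds hz] with y hy
    rw [ec, ed, (jacobiWeight_hasDerivAt _ _ hy).deriv, hf]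
    push_cast
    ring
  rw [iteratedDeriv_succ_linear_mul hU hgs _ _ _ z hz,
    iteratedDeriv_succ_linear_mul hU hfs _ _ _ z hz,
    iteratedDeriv_succ_linear_mul hU hfs _ _ _ z hz] at h1
  rw [iteratedDeriv_succ_linear_mul hU hfs _ _ _ z hz] at h2
  rw [(rodriguesDeriv_hasDerivAt α β (k + 1) hz).deriv]
  have h3 : rodriguesDeriv α β (k + 1) z = iteratedDeriv (k + 1) f z := rfl
  rw [h3, ← hf]
  push_cast at h1 h2 ⊢
  linear_combination (-(α + β + 2 * k + 4)) * h1 + (k + 2) * h2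

theorem jacobiP_eq (α β : ℝ) (n : ℕ) (z : ℝ) :
    jacobiP α β n z = (1 - z) ^ (-α) * (1 + z) ^ (-β) *
      ((-1 : ℝ) ^ n / ((2 : ℝ) ^ n * (Nat.factorial n : ℝ)) * rodriguesDeriv α β n z) := rfl

theorem jacobiP_raising (α β : ℝ) (k : ℕ) {z : ℝ} (hz : z ∈ Ioo (-1 : ℝ) 1) :
    ∃ P' : ℝ, HasDerivAt (jacobiP α β (k + 1)) P' z ∧
      (α + β + 2 * k + 4) * ((1 - z ^ 2) * P') =
        (k + 2 + α + β) * (α - β + (α + β + 2 * k + 4) * z) * jacobiP α β (k + 1) z -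
        2 * (k + 2) * (k + 2 + α + β) * jacobiP α β (k + 2) z := by
  have h1 : (1 : ℝ) - z ≠ 0 := by linarith [hz.2] |> fun h : 0 < 1 - z => h.ne'
  have h2 : (1 : ℝ) + z ≠ 0 := by linarith [hz.1] |> fun h : 0 < 1 + z => h.ne'
  have e1 : HasDerivAt (fun t : ℝ => (1 - t) ^ (-α)) (α * (1 - z) ^ (-α) / (1 - z)) z := by
    have h := ((hasDerivAt_id z).const_sub 1).rpow_const (p := -α) (Or.inl h1)
    simp only [id] at h
    refine h.congr_deriv ?_
    rw [rpow_sub_one h1]; ring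
  have e2 : HasDerivAt (fun t : ℝ => (1 + t) ^ (-β)) (-β * (1 + z) ^ (-β) / (1 + z)) z := by
    have h := ((hasDerivAt_id z).const_add 1).rpow_const (p := -β) (Or.inl h2)
    simp only [id] at h
    refine h.congr_deriv ?_
    rw [rpow_sub_one h2]; ring
  have hR := (rodriguesDeriv_hasDerivAt α β (k + 1) hz)
  have hr := rodriguesDeriv_raising α β k hz
  rw [hR.deriv] at hr
  have h := (e1.mul e2).mul (hR.const_mul
    ((-1 : ℝ) ^ (k + 1) / ((2 : ℝ) ^ (k + 1) * (Nat.factorial (k + 1) : ℝ))))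
  refine ⟨_, h, ?_⟩
  rw [jacobiP_eq, jacobiP_eq]
  have hk : (-1 : ℝ) ^ (k + 2) / ((2 : ℝ) ^ (k + 2) * (Nat.factorial (k + 2) : ℝ)) =
    (-1 : ℝ) ^ (k + 1) / ((2 : ℝ) ^ (k + 1) * (Nat.factorial (k + 1) : ℝ)) *
      (-1 / (2 * (k + 2))) := by
    have : (k : ℝ) + 2 ≠ 0 := by positivity
    rw [Nat.factorial_succ (k + 1)]
    push_cast
    field_simp
    ring
  rw [hk]
  set c := (-1 : ℝ) ^ (k + 1) / ((2 : ℝ) ^ (k + 1) * (Nat.factorial (k + 1) : ℝ))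
  set A := (1 - z) ^ (-α)
  set B := (1 + z) ^ (-β)
  have : (k : ℝ) + 2 ≠ 0 := by positivity
  have hz2 : (1 : ℝ) - z ^ 2 = (1 - z) * (1 + z) := by ring
  simp only [Pi.mul_apply]
  rw [hz2] at hr ⊢
  field_simp
  linear_combination (A * B * c) * hr

/-! ### Jacobi polynomials by recursion, their differential equation and the lowering relation. -/

open Polynomial in
/-- The Jacobi polynomials as polynomials, by the raising recursion. -/
noncomputable def jacobiPoly (α β : ℝ) : ℕ → ℝ[X]
  | 0 => 1
  | 1 => C ((α - β) / 2) + C ((α + β + 2) / 2) * X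
  | k + 2 => C (1 / (2 * (k + 2) * (k + 2 + α + β))) *
      ((C (α - β) + C (α + β + 2 * k + 4) * X) * C (k + 2 + α + β) * jacobiPoly α β (k + 1) -
        C (α + β + 2 * k + 4) * ((1 - X ^ 2) * derivative (jacobiPoly α β (k + 1))))

theorem jacobiPoly_raising {α β : ℝ} (h : -1 ≤ α + β) (k : ℕ) (z : ℝ) :
    (α + β + 2 * k + 4) * ((1 - z ^ 2) * (jacobiPoly α β (k + 1)).derivative.eval z) =
      (k + 2 + α + β) * (α - β + (α + β + 2 * k + 4) * z) * (jacobiPoly α β (k + 1)).eval z -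
      2 * (k + 2) * (k + 2 + α + β) * (jacobiPoly α β (k + 2)).eval z := by
  have hk : (0 : ℝ) ≤ k := k.cast_nonneg
  have h1 : (k : ℝ) + 2 ≠ 0 := by positivity
  have h2 : (k : ℝ) + 2 + α + β ≠ 0 := by
    have : 0 < (k : ℝ) + 2 + α + β := by linarith
    exact this.ne'
  rw [jacobiPoly]
  simp only [Polynomial.eval_mul, Polynomial.eval_sub, Polynomial.eval_add, Polynomial.eval_C,
    Polynomial.eval_X, Polynomial.eval_one, Polynomial.eval_pow]
  field_simp
  ring

/-- Both sides obey the same raising relation. The induction starts at degree 1, since raising from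
degree 0 would divide by α + β + 1, which may vanish. -/
theorem jacobiP_eq_eval {α β : ℝ} (h : -1 ≤ α + β) (n : ℕ) :
    ∀ z ∈ Ioo (-1 : ℝ) 1, jacobiP α β (n + 1) z = (jacobiPoly α β (n + 1)).eval z := by
  induction n with
  | zero =>
    intro z hz
    have h1 : (0 : ℝ) < 1 - z := by linarith [hz.2]
    have h2 : (0 : ℝ) < 1 + z := by linarith [hz.1]
    rw [jacobiP_eq, rodriguesDeriv_one α β hz, jacobiWeight, rpow_neg h1.le, rpow_neg h2.le]
    have h3 := (rpow_pos_of_pos h1 α).ne'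
    have h4 := (rpow_pos_of_pos h2 β).ne'
    simp only [jacobiPoly, Polynomial.eval_mul, Polynomial.eval_add, Polynomial.eval_C,
      Polynomial.eval_X]
    simp
    field_simp
    ring
  | succ k ih =>
    intro z hz
    obtain ⟨P', hP, hr⟩ := jacobiP_raising α β k hz
    have he : jacobiP α β (k + 1) =ᶠ[𝓝 z] fun z => (jacobiPoly α β (k + 1)).eval z := by
      filter_upwards [isOpen_Ioo.mem_nhds hz] with y hy using ih y hy
    have hP' : P' = (jacobiPoly α β (k + 1)).derivative.eval z :=
      (hP.congr_of_eventuallyEq he.symm).unique ((jacobiPoly α β (k + 1)).hasDerivAt z)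
    have hr' := jacobiPoly_raising h k z
    rw [hP', ih z hz, hr'] at hr
    have hk : (0 : ℝ) ≤ k := k.cast_nonneg
    have h1 : (0 : ℝ) < 2 * (k + 2) * (k + 2 + α + β) := by
      have : 0 < (k : ℝ) + 2 + α + β := by linarith
      positivity
    have := sub_right_injective hr
    exact (mul_left_cancel₀ h1.ne' this).symm

/-- The Jacobi differential equation with eigenvalue `lam`. -/
def JacobiODE (α β lam : ℝ) (Q : Polynomial ℝ) : Prop :=
  ∀ z : ℝ, (1 - z ^ 2) * Q.derivative.derivative.eval z +
    (β - α - (α + β + 2) * z) * Q.derivative.eval z + lam * Q.eval z = 0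

/-- Differentiating the recursion that defines degree k + 2 produces the second derivative of degree
k + 1, which the differential equation eliminates. This is one half of an induction alternating with
`jacobiPoly_ode`. -/
theorem jacobiPoly_lowering_of_ode {α β : ℝ} (h : -1 ≤ α + β) (k : ℕ)
    (hode : JacobiODE α β ((k + 1) * (k + 2 + α + β)) (jacobiPoly α β (k + 1))) (z : ℝ) :
    (α + β + 2 * k + 4) * ((1 - z ^ 2) * (jacobiPoly α β (k + 2)).derivative.eval z) =
      (k + 2) * (α - β - (α + β + 2 * k + 4) * z) * (jacobiPoly α β (k + 2)).eval z +
      2 * (k + 2 + α) * (k + 2 + β) * (jacobiPoly α β (k + 1)).eval z := by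
  have hk : (0 : ℝ) ≤ k := k.cast_nonneg
  have h1 : (k : ℝ) + 2 ≠ 0 := by positivity
  have h2 : (k : ℝ) + 2 + α + β ≠ 0 := by
    have : 0 < (k : ℝ) + 2 + α + β := by linarith
    exact this.ne'
  have ho := hode z
  rw [jacobiPoly]
  simp only [Polynomial.derivative_mul, Polynomial.derivative_sub, Polynomial.derivative_add,
    Polynomial.derivative_C, Polynomial.derivative_X, Polynomial.derivative_one,
    Polynomial.derivative_X_pow, Polynomial.eval_mul, Polynomial.eval_sub, Polynomial.eval_add,
    Polynomial.eval_C, Polynomial.eval_X, Polynomial.eval_one, Polynomial.eval_pow,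
    Polynomial.eval_zero]
  norm_num
  field_simp
  linear_combination (-(α + β + 2 * k + 4) ^ 2 * (1 - z ^ 2)) * ho

/-- In the inductive step the lowering relation is differentiated and the derivative of the lower
polynomial is removed by the raising relation. This yields 1 - X² times the equation, and that
factor cancels in the polynomial ring. -/
theorem jacobiPoly_ode {α β : ℝ} (h : -1 ≤ α + β) (k : ℕ) :
    JacobiODE α β ((k + 1) * (k + 2 + α + β)) (jacobiPoly α β (k + 1)) := by
  induction k with
  | zero =>
    intro z
    simp only [jacobiPoly]
    simp
    ring
  | succ k ih =>
    have hk : (0 : ℝ) ≤ k := k.cast_nonneg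
    have hτ : α + β + 2 * k + 4 ≠ 0 := by
      have : 0 < α + β + 2 * k + 4 := by linarith
      exact this.ne'
    set P := jacobiPoly α β (k + 1) with hP
    set Q := jacobiPoly α β (k + 2) with hQ
    have hL := jacobiPoly_lowering_of_ode h k ih
    have hR := jacobiPoly_raising h k
    rw [← hP, ← hQ] at hL hR
    have hpoly : Polynomial.C (α + β + 2 * k + 4) * ((1 - Polynomial.X ^ 2) * Q.derivative) =
        Polynomial.C ((k : ℝ) + 2) * (Polynomial.C (α - β) - Polynomial.C (α + β + 2 * k + 4) *
          Polynomial.X) * Q + Polynomial.C (2 * (k + 2 + α) * (k + 2 + β)) * P := by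
      refine Polynomial.funext fun z => ?_
      have := hL z
      simp only [Polynomial.eval_mul, Polynomial.eval_sub, Polynomial.eval_add, Polynomial.eval_C,
        Polynomial.eval_X, Polynomial.eval_one, Polynomial.eval_pow]
      exact this
    have hder : ∀ z : ℝ, (α + β + 2 * k + 4) * ((1 - z ^ 2) * Q.derivative.derivative.eval z -
        2 * z * Q.derivative.eval z) = (k + 2) * (α - β - (α + β + 2 * k + 4) * z) *
          Q.derivative.eval z - (k + 2) * (α + β + 2 * k + 4) * Q.eval z +
          2 * (k + 2 + α) * (k + 2 + β) * P.derivative.eval z := by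
      intro z
      have := congrArg (fun p => (Polynomial.derivative p).eval z) hpoly
      simp only [Polynomial.derivative_mul, Polynomial.derivative_sub, Polynomial.derivative_add,
        Polynomial.derivative_C, Polynomial.derivative_X, Polynomial.derivative_one,
        Polynomial.derivative_X_pow, Polynomial.eval_mul, Polynomial.eval_sub,
        Polynomial.eval_add, Polynomial.eval_C, Polynomial.eval_X, Polynomial.eval_one,
        Polynomial.eval_pow, Polynomial.eval_zero] at this
      norm_num at this
      linear_combination this
    have hmul : (1 - Polynomial.X ^ 2) * ((1 - Polynomial.X ^ 2) * Q.derivative.derivative +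
        (Polynomial.C (β - α) - Polynomial.C (α + β + 2) * Polynomial.X) * Q.derivative +
        Polynomial.C ((k + 2) * (k + 3 + α + β)) * Q) = 0 := by
      refine Polynomial.funext fun z => ?_
      simp only [Polynomial.eval_mul, Polynomial.eval_sub, Polynomial.eval_add, Polynomial.eval_C,
        Polynomial.eval_X, Polynomial.eval_one, Polynomial.eval_pow, Polynomial.eval_zero]
      have h1 := hL z
      have h2 := hR z
      have h3 := hder z
      refine mul_left_cancel₀ (pow_ne_zero 2 hτ) ?_
      linear_combination (α + β + 2 * k + 4) * (1 - z ^ 2) * h3 +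
        2 * (k + 2 + α) * (k + 2 + β) * h2 +
        ((k + 2) * (α - β - (α + β + 2 * k + 4) * z) + 2 * z * (α + β + 2 * k + 4) +
          (β - α - (α + β + 2) * z) * (α + β + 2 * k + 4)) * h1
    have hne : (1 - Polynomial.X ^ 2 : Polynomial ℝ) ≠ 0 := by
      intro h0
      have := congrArg (Polynomial.eval 0) h0
      simp at this
    have h0 := (mul_eq_zero.mp hmul).resolve_left hne
    intro z
    have := congrArg (Polynomial.eval z) h0
    simp only [Polynomial.eval_mul, Polynomial.eval_sub, Polynomial.eval_add, Polynomial.eval_C,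
      Polynomial.eval_X, Polynomial.eval_one, Polynomial.eval_pow, Polynomial.eval_zero] at this
    push_cast
    linear_combination this

theorem jacobiPoly_lowering {α β : ℝ} (h : -1 ≤ α + β) (k : ℕ) (z : ℝ) :
    (α + β + 2 * k + 4) * ((1 - z ^ 2) * (jacobiPoly α β (k + 2)).derivative.eval z) =
      (k + 2) * (α - β - (α + β + 2 * k + 4) * z) * (jacobiPoly α β (k + 2)).eval z +
      2 * (k + 2 + α) * (k + 2 + β) * (jacobiPoly α β (k + 1)).eval z :=
  jacobiPoly_lowering_of_ode h k (jacobiPoly_ode h k) z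

/-! ### Liouville normal form and orthogonality. -/

/-- The half-angle weight `sin (x/2)^(α+1/2) cos (x/2)^(β+1/2)`. -/
noncomputable def halfWeight (α β x : ℝ) : ℝ :=
  sin (x / 2) ^ (α + 1 / 2) * cos (x / 2) ^ (β + 1 / 2)

/-- The logarithmic derivative of `halfWeight`. -/
noncomputable def halfWeightLog (α β x : ℝ) : ℝ :=
  (α + 1 / 2) / 2 * (cos (x / 2) / sin (x / 2)) - (β + 1 / 2) / 2 * (sin (x / 2) / cos (x / 2))

/-- The potential of the Liouville normal form. -/
noncomputable def jacobiPot (α β x : ℝ) : ℝ :=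
  (α ^ 2 - 1 / 4) / (4 * sin (x / 2) ^ 2) + (β ^ 2 - 1 / 4) / (4 * cos (x / 2) ^ 2)

/-- The weighted trigonometric polynomial `halfWeight · Q(cos x)`. -/
noncomputable def weightedPoly (α β : ℝ) (Q : Polynomial ℝ) (x : ℝ) : ℝ :=
  halfWeight α β x * Q.eval (cos x)

/-- The derivative of `weightedPoly` on `(0, π)`. -/
noncomputable def weightedPolyDeriv (α β : ℝ) (Q : Polynomial ℝ) (x : ℝ) : ℝ :=
  halfWeight α β x * (halfWeightLog α β x * Q.eval (cos x) - sin x * Q.derivative.eval (cos x))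

theorem sin_half_pos {x : ℝ} (hx : x ∈ Ioo 0 π) : 0 < sin (x / 2) :=
  sin_pos_of_pos_of_lt_pi (by linarith [hx.1]) (by linarith [hx.2, hx.1])

theorem cos_half_pos {x : ℝ} (hx : x ∈ Ioo 0 π) : 0 < cos (x / 2) :=
  cos_pos_of_mem_Ioo ⟨by linarith [hx.1, pi_pos], by linarith [hx.2]⟩

theorem cos_eq_half (x : ℝ) : cos x = cos (x / 2) ^ 2 - sin (x / 2) ^ 2 := by
  conv_lhs => rw [show x = 2 * (x / 2) by ring]
  rw [cos_two_mul']

theorem sin_eq_half (x : ℝ) : sin x = 2 * sin (x / 2) * cos (x / 2) := by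
  conv_lhs => rw [show x = 2 * (x / 2) by ring]
  rw [sin_two_mul]

theorem cos_mem_Ioo {x : ℝ} (hx : x ∈ Ioo 0 π) : cos x ∈ Ioo (-1 : ℝ) 1 := by
  have h1 := sin_half_pos hx
  have h2 := cos_half_pos hx
  have h3 := sin_sq_add_cos_sq (x / 2)
  have h4 := cos_eq_half x
  constructor <;> nlinarith [pow_pos h1 2, pow_pos h2 2]

theorem hasDerivAt_sin_half (x : ℝ) :
    HasDerivAt (fun x : ℝ => sin (x / 2)) (cos (x / 2) / 2) x := by
  refine (((hasDerivAt_id x).div_const 2).sin).congr_deriv ?_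
  simp only [id]
  ring

theorem hasDerivAt_cos_half (x : ℝ) :
    HasDerivAt (fun x : ℝ => cos (x / 2)) (-sin (x / 2) / 2) x := by
  refine (((hasDerivAt_id x).div_const 2).cos).congr_deriv ?_
  simp only [id]
  ring

theorem hasDerivAt_halfWeight (α β : ℝ) {x : ℝ} (hx : x ∈ Ioo 0 π) :
    HasDerivAt (halfWeight α β) (halfWeight α β x * halfWeightLog α β x) x := by
  have h1 := sin_half_pos hx
  have h2 := cos_half_pos hx
  have e1 := (hasDerivAt_sin_half x).rpow_const (p := α + 1 / 2) (Or.inl h1.ne')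
  have e2 := (hasDerivAt_cos_half x).rpow_const (p := β + 1 / 2) (Or.inl h2.ne')
  refine (e1.mul e2).congr_deriv ?_
  unfold halfWeight halfWeightLog
  rw [rpow_sub_one h1.ne', rpow_sub_one h2.ne']
  field_simp
  ring

theorem hasDerivAt_halfWeightLog (α β : ℝ) {x : ℝ} (hx : x ∈ Ioo 0 π) :
    HasDerivAt (halfWeightLog α β)
      (-(α + 1 / 2) / (4 * sin (x / 2) ^ 2) - (β + 1 / 2) / (4 * cos (x / 2) ^ 2)) x := by
  have h1 := sin_half_pos hx
  have h2 := cos_half_pos hx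
  have e1 := ((hasDerivAt_cos_half x).div (hasDerivAt_sin_half x) h1.ne').const_mul
    ((α + 1 / 2) / 2)
  have e2 := ((hasDerivAt_sin_half x).div (hasDerivAt_cos_half x) h2.ne').const_mul
    ((β + 1 / 2) / 2)
  refine (e1.sub e2).congr_deriv ?_
  have h3 := sin_sq_add_cos_sq (x / 2)
  have h4 : cos (x / 2) ^ 2 = 1 - sin (x / 2) ^ 2 := by linarith
  have e3 : (-sin (x / 2) / 2 * sin (x / 2) - cos (x / 2) * (cos (x / 2) / 2)) = - 1 / 2 := by
    linarith
  have e4 : (cos (x / 2) / 2 * cos (x / 2) - sin (x / 2) * (-sin (x / 2) / 2)) = 1 / 2 := by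
    linarith
  rw [e3, e4]
  field_simp
  ring

theorem hasDerivAt_eval_cos (Q : Polynomial ℝ) (x : ℝ) :
    HasDerivAt (fun x => Q.eval (cos x)) (-(sin x * Q.derivative.eval (cos x))) x := by
  have := (Q.hasDerivAt (cos x)).comp x (hasDerivAt_cos x)
  exact this.congr_deriv (by ring)

theorem hasDerivAt_weightedPoly (α β : ℝ) (Q : Polynomial ℝ) {x : ℝ} (hx : x ∈ Ioo 0 π) :
    HasDerivAt (weightedPoly α β Q) (weightedPolyDeriv α β Q x) x := by
  refine ((hasDerivAt_halfWeight α β hx).mul (hasDerivAt_eval_cos Q x)).congr_deriv ?_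
  unfold weightedPolyDeriv
  ring

/-- The weight is chosen so that the first-order term disappears. For the degree n eigenvalue
n(n+α+β+1), the shift by (α+β+1)²/4 completes the square to (n + (α+β+1)/2)². -/
theorem hasDerivAt_weightedPolyDeriv {α β lam : ℝ} {Q : Polynomial ℝ} (hQ : JacobiODE α β lam Q)
    {x : ℝ} (hx : x ∈ Ioo 0 π) :
    HasDerivAt (weightedPolyDeriv α β Q)
      ((jacobiPot α β x - (lam + (α + β + 1) ^ 2 / 4)) * weightedPoly α β Q x) x := by
  have e := (hasDerivAt_halfWeight α β hx).mul
    (((hasDerivAt_halfWeightLog α β hx).mul (hasDerivAt_eval_cos Q x)).sub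
      ((hasDerivAt_sin x).mul (hasDerivAt_eval_cos Q.derivative x)))
  refine e.congr_deriv ?_
  have ho := hQ (cos x)
  have h1 := sin_half_pos hx
  have h2 := cos_half_pos hx
  have h3 : cos (x / 2) ^ 2 = 1 - sin (x / 2) ^ 2 := by linarith [sin_sq_add_cos_sq (x / 2)]
  have h5 : 1 - cos x ^ 2 = sin x ^ 2 := by linarith [sin_sq_add_cos_sq x]
  rw [h5] at ho
  unfold weightedPoly jacobiPot
  simp only [Pi.mul_apply, Pi.sub_apply]
  have e1 : halfWeightLog α β x * sin x = (α + β + 1) / 2 * cos x + (α - β) / 2 := by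
    unfold halfWeightLog
    rw [sin_eq_half x, cos_eq_half x]
    field_simp
    linear_combination (α - β) * h3
  have e2 : halfWeightLog α β x ^ 2 + (-(α + 1 / 2) / (4 * sin (x / 2) ^ 2) -
      (β + 1 / 2) / (4 * cos (x / 2) ^ 2)) = jacobiPot α β x - (α + β + 1) ^ 2 / 4 := by
    unfold halfWeightLog jacobiPot
    field_simp
    rw [h3]
    ring
  unfold jacobiPot at e2
  linear_combination halfWeight α β x * (Q.eval (cos x)) * e2 -
    2 * halfWeight α β x * Q.derivative.eval (cos x) * e1 + halfWeight α β x * ho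

theorem sin_mul_halfWeightLog (α β : ℝ) {x : ℝ} (hx : x ∈ Ioo 0 π) :
    sin x * halfWeightLog α β x = (α + β + 1) / 2 * cos x + (α - β) / 2 := by
  have h1 := sin_half_pos hx
  have h2 := cos_half_pos hx
  unfold halfWeightLog
  rw [sin_eq_half x, cos_eq_half x]
  field_simp
  linear_combination (α - β) * (sin_sq_add_cos_sq (x / 2))

theorem continuous_halfWeight {α β : ℝ} (hα : -1 / 2 ≤ α) (hβ : -1 / 2 ≤ β) :
    Continuous (halfWeight α β) := by
  unfold halfWeight
  have h1 : Continuous fun x : ℝ => sin (x / 2) := by fun_prop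
  have h2 : Continuous fun x : ℝ => cos (x / 2) := by fun_prop
  exact ((Real.continuous_rpow_const (by linarith)).comp h1).mul
    ((Real.continuous_rpow_const (by linarith)).comp h2)

theorem continuous_eval_cos (Q : Polynomial ℝ) : Continuous fun x => Q.eval (cos x) :=
  Q.continuous.comp continuous_cos

theorem continuous_weightedPoly {α β : ℝ} (hα : -1 / 2 ≤ α) (hβ : -1 / 2 ≤ β)
    (Q : Polynomial ℝ) : Continuous (weightedPoly α β Q) :=
  (continuous_halfWeight hα hβ).mul (continuous_eval_cos Q)

/-- The Wronskian has derivative (l₁ - l₂) times the integrand. The singular logarithmic derivatives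
of the weight cancel in it, so it extends continuously to [0,π] and vanishes at both ends through
its factor sin x. -/
theorem integral_weightedPoly_mul_eq_zero {α β l₁ l₂ : ℝ} (hα : -1 / 2 ≤ α) (hβ : -1 / 2 ≤ β)
    {P Q : Polynomial ℝ} (hP : JacobiODE α β l₁ P) (hQ : JacobiODE α β l₂ Q) (hl : l₁ ≠ l₂) :
    ∫ x in (0 : ℝ)..π, weightedPoly α β P x * weightedPoly α β Q x = 0 := by
  set W : ℝ → ℝ := fun x => halfWeight α β x ^ 2 * (-sin x) *
    (P.eval (cos x) * Q.derivative.eval (cos x) - P.derivative.eval (cos x) * Q.eval (cos x))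
    with hW
  have hc : Continuous W :=
    (((continuous_halfWeight hα hβ).pow 2).mul continuous_sin.neg).mul
      (((continuous_eval_cos P).mul (continuous_eval_cos _)).sub
        ((continuous_eval_cos _).mul (continuous_eval_cos Q)))
  have hd : ∀ x ∈ Ioo 0 π, HasDerivAt W
      ((l₁ - l₂) * (weightedPoly α β P x * weightedPoly α β Q x)) x := by
    intro x hx
    have h := ((hasDerivAt_weightedPoly α β P hx).mul (hasDerivAt_weightedPolyDeriv hQ hx)).sub
      ((hasDerivAt_weightedPolyDeriv hP hx).mul (hasDerivAt_weightedPoly α β Q hx))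
    have he : W = weightedPoly α β P * weightedPolyDeriv α β Q -
        weightedPolyDeriv α β P * weightedPoly α β Q := by
      funext y
      simp only [hW, Pi.sub_apply, Pi.mul_apply, weightedPoly, weightedPolyDeriv]
      ring
    rw [he]
    exact h.congr_deriv (by ring)
  have hcu := (continuous_weightedPoly hα hβ P).mul (continuous_weightedPoly hα hβ Q)
  have h := integral_eq_sub_of_hasDerivAt_of_le pi_pos.le hc.continuousOn hd
    ((hcu.const_mul (l₁ - l₂)).intervalIntegrable _ _)
  rw [intervalIntegral.integral_const_mul] at h
  simp only [hW, sin_pi, sin_zero, neg_zero, mul_zero, zero_mul, sub_zero] at h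
  exact (mul_eq_zero.mp h).resolve_left (sub_ne_zero.mpr hl)

/-! ### Normalization and ladder relations. -/

/-- The normalized function `p_n` through the polynomial `jacobiPoly`, defined on all of `ℝ`. -/
noncomputable def jacobiU (α β : ℝ) (n : ℕ) (x : ℝ) : ℝ :=
  jacobiW α β n * weightedPoly α β (jacobiPoly α β n) x

/-- The derivative of `jacobiU` on `(0, π)`. -/
noncomputable def jacobiUDeriv (α β : ℝ) (n : ℕ) (x : ℝ) : ℝ :=
  jacobiW α β n * weightedPolyDeriv α β (jacobiPoly α β n) x

/-- The frequency `n + (α + β + 1)/2`. -/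
noncomputable def jacobiFreq (α β : ℝ) (n : ℕ) : ℝ := n + (α + β + 1) / 2

/-- Twice the off-diagonal entry of the Jacobi matrix, for `n = k + 1`. -/
noncomputable def jacobiOffDiag (α β : ℝ) (k : ℕ) : ℝ :=
  2 * (k + 2) * (k + 2 + α + β) / ((α + β + 2 * k + 4) * jacobiFreq α β (k + 1)) *
    (jacobiW α β (k + 1) / jacobiW α β (k + 2))

theorem jacobiFun_eq {α β : ℝ} (h : -1 ≤ α + β) (k : ℕ) {x : ℝ} (hx : x ∈ Ioo 0 π) :
    jacobiFun α β (k + 1) x = jacobiU α β (k + 1) x := by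
  unfold jacobiFun jacobiU weightedPoly halfWeight
  rw [jacobiP_eq_eval h k _ (cos_mem_Ioo hx)]
  ring

theorem jacobiW_pos {α β : ℝ} (hα : -1 / 2 ≤ α) (hβ : -1 / 2 ≤ β) (k : ℕ) :
    0 < jacobiW α β (k + 1) := by
  have hk : (0 : ℝ) ≤ k := k.cast_nonneg
  rw [jacobiW, if_neg (Nat.succ_ne_zero k)]
  push_cast
  refine sqrt_pos.mpr ?_
  have h1 := Gamma_pos_of_pos (s := (k : ℝ) + 1 + 1) (by linarith)
  have h2 := Gamma_pos_of_pos (s := (k : ℝ) + 1 + α + β + 1) (by linarith)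
  have h3 := Gamma_pos_of_pos (s := (k : ℝ) + 1 + α + 1) (by linarith)
  have h4 := Gamma_pos_of_pos (s := (k : ℝ) + 1 + β + 1) (by linarith)
  have h5 : 0 < 2 * ((k : ℝ) + 1) + α + β + 1 := by linarith
  positivity

theorem jacobiW_succ_sq {α β : ℝ} (hα : -1 / 2 ≤ α) (hβ : -1 / 2 ≤ β) (k : ℕ) :
    jacobiW α β (k + 2) ^ 2 * (jacobiFreq α β (k + 1) * ((k + 2 + α) * (k + 2 + β))) =
      jacobiW α β (k + 1) ^ 2 * (jacobiFreq α β (k + 2) * ((k + 2) * (k + 2 + α + β))) := by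
  have hk : (0 : ℝ) ≤ k := k.cast_nonneg
  rw [jacobiW, if_neg (Nat.succ_ne_zero _), jacobiW, if_neg (Nat.succ_ne_zero k)]
  push_cast
  have g1 := Gamma_add_one (s := (k : ℝ) + 2) (by linarith)
  have g2 := Gamma_add_one (s := (k : ℝ) + 2 + α + β) (by linarith)
  have g3 := Gamma_add_one (s := (k : ℝ) + 2 + α) (by linarith)
  have g4 := Gamma_add_one (s := (k : ℝ) + 2 + β) (by linarith)
  have h1 := Gamma_pos_of_pos (s := (k : ℝ) + 2) (by linarith)
  have h2 := Gamma_pos_of_pos (s := (k : ℝ) + 2 + α + β) (by linarith)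
  have h3 := Gamma_pos_of_pos (s := (k : ℝ) + 2 + α) (by linarith)
  have h4 := Gamma_pos_of_pos (s := (k : ℝ) + 2 + β) (by linarith)
  rw [g1, g2, g3, g4, show (k : ℝ) + 1 + 1 = k + 2 by ring,
    show (k : ℝ) + 1 + α + β + 1 = k + 2 + α + β by ring,
    show (k : ℝ) + 1 + α + 1 = k + 2 + α by ring, show (k : ℝ) + 1 + β + 1 = k + 2 + β by ring]
  have p1 : 0 < (k : ℝ) + 2 + α + β := by linarith
  have p2 : 0 < (k : ℝ) + 2 + α := by linarith
  have p3 : 0 < (k : ℝ) + 2 + β := by linarith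
  have p4 : 0 < 2 * ((k : ℝ) + 2) + α + β + 1 := by linarith
  have p5 : 0 < 2 * ((k : ℝ) + 1) + α + β + 1 := by linarith
  rw [sq_sqrt (by positivity), sq_sqrt (by positivity)]
  unfold jacobiFreq
  push_cast
  field_simp
  ring

theorem jacobiFreq_ge {α β : ℝ} (h : -1 ≤ α + β) (n : ℕ) : (n : ℝ) ≤ jacobiFreq α β n := by
  unfold jacobiFreq
  linarith

theorem jacobiFreq_pos {α β : ℝ} (h : -1 ≤ α + β) (k : ℕ) : 0 < jacobiFreq α β (k + 1) := by
  have := jacobiFreq_ge h (k + 1)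
  push_cast at this
  have hk : (0 : ℝ) ≤ k := k.cast_nonneg
  linarith

theorem jacobiOffDiag_pos {α β : ℝ} (hα : -1 / 2 ≤ α) (hβ : -1 / 2 ≤ β) (k : ℕ) :
    0 < jacobiOffDiag α β k := by
  have hk : (0 : ℝ) ≤ k := k.cast_nonneg
  have h1 := jacobiFreq_pos (α := α) (β := β) (by linarith) k
  have h2 := jacobiW_pos hα hβ k
  have h3 := jacobiW_pos hα hβ (k + 1)
  have p1 : 0 < (k : ℝ) + 2 + α + β := by linarith
  have p2 : 0 < α + β + 2 * k + 4 := by linarith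
  unfold jacobiOffDiag
  positivity

/-- The normalization symmetrizes the recurrence: the coefficient coming from raising equals the one
coming from lowering. Multiplying the two forms removes the Gamma factors and gives
`jacobiOffDiag_sq`. -/
theorem jacobiOffDiag_eq {α β : ℝ} (hα : -1 / 2 ≤ α) (hβ : -1 / 2 ≤ β) (k : ℕ) :
    jacobiOffDiag α β k =
      2 * (k + 2 + α) * (k + 2 + β) / ((α + β + 2 * k + 4) * jacobiFreq α β (k + 2)) *
        (jacobiW α β (k + 2) / jacobiW α β (k + 1)) := by
  have hk : (0 : ℝ) ≤ k := k.cast_nonneg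
  have h1 := jacobiFreq_pos (α := α) (β := β) (by linarith) k
  have h1' := jacobiFreq_pos (α := α) (β := β) (by linarith) (k + 1)
  have h2 := jacobiW_pos hα hβ k
  have h3 := jacobiW_pos hα hβ (k + 1)
  have p2 : 0 < α + β + 2 * k + 4 := by linarith
  have h := jacobiW_succ_sq hα hβ k
  have e : k + 1 + 1 = k + 2 := rfl
  rw [e] at h1' h3
  unfold jacobiOffDiag
  field_simp
  linear_combination -h

theorem jacobiOffDiag_sq {α β : ℝ} (hα : -1 / 2 ≤ α) (hβ : -1 / 2 ≤ β) (k : ℕ) :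
    jacobiOffDiag α β k ^ 2 * ((α + β + 2 * k + 4) ^ 2 *
        (jacobiFreq α β (k + 1) * jacobiFreq α β (k + 2))) =
      4 * (k + 2) * (k + 2 + α + β) * (k + 2 + α) * (k + 2 + β) := by
  have hk : (0 : ℝ) ≤ k := k.cast_nonneg
  have h1 := jacobiFreq_pos (α := α) (β := β) (by linarith) k
  have h1' := jacobiFreq_pos (α := α) (β := β) (by linarith) (k + 1)
  have h2 := jacobiW_pos hα hβ k
  have h3 := jacobiW_pos hα hβ (k + 1)
  have p2 : 0 < α + β + 2 * k + 4 := by linarith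
  have e : k + 1 + 1 = k + 2 := rfl
  rw [e] at h1' h3
  rw [sq]
  nth_rw 2 [jacobiOffDiag_eq hα hβ]
  unfold jacobiOffDiag
  field_simp
  ring

/-- With X = k + 2 + (α+β)/2 the squared coefficient is (X² - (α+β)²/4)(X² - (α-β)²/4) / (X²(X² -
1/4)), which is 1 + O(X⁻²). Positivity of the coefficient passes this to the coefficient itself. -/
theorem abs_jacobiOffDiag_sub_one_le {α β : ℝ} (hα : -1 / 2 ≤ α) (hβ : -1 / 2 ≤ β) (k : ℕ) :
    |jacobiOffDiag α β k - 1| ≤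
      (1 + (α + β) ^ 2 + (α - β) ^ 2 + (α + β) ^ 2 * (α - β) ^ 2) / ((k : ℝ) + 1) ^ 2 := by
  have hk : (0 : ℝ) ≤ k := k.cast_nonneg
  have he := jacobiOffDiag_pos hα hβ k
  have hs := jacobiOffDiag_sq hα hβ k
  set e := jacobiOffDiag α β k
  set X := k + 2 + (α + β) / 2 with hX
  have hX1 : (k : ℝ) + 3 / 2 ≤ X := by rw [hX]; linarith
  have hfr : jacobiFreq α β (k + 1) * jacobiFreq α β (k + 2) = X ^ 2 - 1 / 4 := by
    unfold jacobiFreq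
    push_cast
    rw [hX]
    ring
  have hk2 : ((k : ℝ) + 1) ^ 2 ≤ X ^ 2 - 1 / 4 := by
    have := pow_le_pow_left₀ (by linarith) hX1 2
    linarith
  have hpos : 0 < ((k : ℝ) + 1) ^ 2 := by positivity
  rw [hfr, show α + β + 2 * k + 4 = 2 * X by rw [hX]; ring] at hs
  have hs' : (e ^ 2 - 1) * (X ^ 2 * (X ^ 2 - 1 / 4)) =
      (1 / 4 - (α + β) ^ 2 / 4 - (α - β) ^ 2 / 4) * X ^ 2 +
        (α + β) ^ 2 / 4 * ((α - β) ^ 2 / 4) := by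
    rw [hX] at hs ⊢
    linear_combination (1 / 4) * hs
  have hX2 : 1 ≤ X ^ 2 := one_le_pow₀ (by linarith)
  set p := (α + β) ^ 2 with hp
  set q := (α - β) ^ 2 with hq
  have hp0 : 0 ≤ p := sq_nonneg _
  have hq0 : 0 ≤ q := sq_nonneg _
  have hpq : 0 ≤ p * q := mul_nonneg hp0 hq0
  have h1 : |e ^ 2 - 1| * (X ^ 2 * (X ^ 2 - 1 / 4)) ≤ (1 + p + q + p * q) * X ^ 2 := by
    have h0 : 0 ≤ X ^ 2 * (X ^ 2 - 1 / 4) := mul_nonneg (by positivity) (by linarith)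
    rw [← abs_of_nonneg h0, ← abs_mul, hs']
    generalize X ^ 2 = t at hX2
    have t1 := mul_nonneg hp0 (zero_le_one.trans hX2)
    have t2 := mul_nonneg hq0 (zero_le_one.trans hX2)
    have t3 := mul_nonneg hpq (sub_nonneg.mpr hX2)
    rw [abs_le]
    constructor <;> linarith
  have h2 : |e ^ 2 - 1| * (X ^ 2 - 1 / 4) ≤ 1 + p + q + p * q := by
    refine le_of_mul_le_mul_right ?_ (by linarith : 0 < X ^ 2)
    linarith
  have h3 : |e - 1| ≤ |e ^ 2 - 1| := by
    rw [show e ^ 2 - 1 = (e - 1) * (e + 1) by ring, abs_mul, abs_of_pos (by linarith : 0 < e + 1)]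
    exact le_mul_of_one_le_right (abs_nonneg _) (by linarith)
  rw [le_div_iff₀ hpos]
  calc |e - 1| * ((k : ℝ) + 1) ^ 2 ≤ |e ^ 2 - 1| * (X ^ 2 - 1 / 4) := by gcongr
    _ ≤ _ := h2

/-- The diagonal coefficient in the ladder relations. -/
noncomputable def jacobiDiag (α β : ℝ) (k : ℕ) : ℝ :=
  (β ^ 2 - α ^ 2) / (2 * (α + β + 2 * k + 4))

theorem sin_mul_jacobiUDeriv_raising {α β : ℝ} (hα : -1 / 2 ≤ α) (hβ : -1 / 2 ≤ β) (k : ℕ)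
    {x : ℝ} (hx : x ∈ Ioo 0 π) :
    sin x * jacobiUDeriv α β (k + 1) x =
      -jacobiFreq α β (k + 1) * cos x * jacobiU α β (k + 1) x +
        jacobiDiag α β k * jacobiU α β (k + 1) x +
        jacobiFreq α β (k + 1) * jacobiOffDiag α β k * jacobiU α β (k + 2) x := by
  have hk : (0 : ℝ) ≤ k := k.cast_nonneg
  have h1 := jacobiFreq_pos (α := α) (β := β) (by linarith) k
  have h2 := jacobiW_pos hα hβ k
  have h3 := jacobiW_pos hα hβ (k + 1)
  have p2 : 0 < α + β + 2 * k + 4 := by linarith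
  have e : k + 1 + 1 = k + 2 := rfl
  rw [e] at h3
  have hr := jacobiPoly_raising (α := α) (β := β) (by linarith) k (cos x)
  have hs := sin_mul_halfWeightLog α β hx
  rw [show 1 - cos x ^ 2 = sin x ^ 2 by linarith [sin_sq_add_cos_sq x]] at hr
  have hoff : jacobiFreq α β (k + 1) * jacobiOffDiag α β k * jacobiW α β (k + 2) =
      2 * (k + 2) * (k + 2 + α + β) / (α + β + 2 * k + 4) * jacobiW α β (k + 1) := by
    unfold jacobiOffDiag
    field_simp
  have hr' : sin x ^ 2 * (jacobiPoly α β (k + 1)).derivative.eval (cos x) =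
      ((k + 2 + α + β) * (α - β + (α + β + 2 * k + 4) * cos x) *
        (jacobiPoly α β (k + 1)).eval (cos x) -
      2 * (k + 2) * (k + 2 + α + β) * (jacobiPoly α β (k + 2)).eval (cos x)) /
        (α + β + 2 * k + 4) := by
    rw [eq_div_iff p2.ne']
    linear_combination hr
  have hd : jacobiDiag α β k - jacobiFreq α β (k + 1) * cos x =
      (α + β + 1) / 2 * cos x + (α - β) / 2 -
      (k + 2 + α + β) * (α - β + (α + β + 2 * k + 4) * cos x) / (α + β + 2 * k + 4) := by
    unfold jacobiDiag jacobiFreq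
    push_cast
    field_simp
    ring
  unfold jacobiUDeriv jacobiU weightedPolyDeriv weightedPoly
  linear_combination (jacobiW α β (k + 1) * halfWeight α β x *
      (jacobiPoly α β (k + 1)).eval (cos x)) * (hs - hd) -
    jacobiW α β (k + 1) * halfWeight α β x * hr' -
    halfWeight α β x * (jacobiPoly α β (k + 2)).eval (cos x) * hoff

theorem sin_mul_jacobiUDeriv_lowering {α β : ℝ} (hα : -1 / 2 ≤ α) (hβ : -1 / 2 ≤ β) (k : ℕ)
    {x : ℝ} (hx : x ∈ Ioo 0 π) :
    sin x * jacobiUDeriv α β (k + 2) x =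
      jacobiFreq α β (k + 2) * cos x * jacobiU α β (k + 2) x -
        jacobiDiag α β k * jacobiU α β (k + 2) x -
        jacobiFreq α β (k + 2) * jacobiOffDiag α β k * jacobiU α β (k + 1) x := by
  have hk : (0 : ℝ) ≤ k := k.cast_nonneg
  have h1 := jacobiFreq_pos (α := α) (β := β) (by linarith) (k + 1)
  have h2 := jacobiW_pos hα hβ k
  have h3 := jacobiW_pos hα hβ (k + 1)
  have p2 : 0 < α + β + 2 * k + 4 := by linarith
  have e : k + 1 + 1 = k + 2 := rfl
  rw [e] at h1 h3
  have hr := jacobiPoly_lowering (α := α) (β := β) (by linarith) k (cos x)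
  have hs := sin_mul_halfWeightLog α β hx
  rw [show 1 - cos x ^ 2 = sin x ^ 2 by linarith [sin_sq_add_cos_sq x]] at hr
  have hoff : jacobiFreq α β (k + 2) * jacobiOffDiag α β k * jacobiW α β (k + 1) =
      2 * (k + 2 + α) * (k + 2 + β) / (α + β + 2 * k + 4) * jacobiW α β (k + 2) := by
    rw [jacobiOffDiag_eq hα hβ]
    field_simp
  have hr' : sin x ^ 2 * (jacobiPoly α β (k + 2)).derivative.eval (cos x) =
      ((k + 2) * (α - β - (α + β + 2 * k + 4) * cos x) *
        (jacobiPoly α β (k + 2)).eval (cos x) +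
      2 * (k + 2 + α) * (k + 2 + β) * (jacobiPoly α β (k + 1)).eval (cos x)) /
        (α + β + 2 * k + 4) := by
    rw [eq_div_iff p2.ne']
    linear_combination hr
  have hd : jacobiFreq α β (k + 2) * cos x - jacobiDiag α β k =
      (α + β + 1) / 2 * cos x + (α - β) / 2 -
      (k + 2) * (α - β - (α + β + 2 * k + 4) * cos x) / (α + β + 2 * k + 4) := by
    have e1 : (α + β + 2 * k + 4) * ((k + 2) * (α - β - (α + β + 2 * k + 4) * cos x) /
        (α + β + 2 * k + 4)) = (k + 2) * (α - β - (α + β + 2 * k + 4) * cos x) :=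
      mul_div_cancel₀ _ p2.ne'
    have e2 : (α + β + 2 * k + 4) * jacobiDiag α β k = (β ^ 2 - α ^ 2) / 2 := by
      unfold jacobiDiag
      field_simp
    refine mul_left_cancel₀ p2.ne' ?_
    unfold jacobiFreq
    push_cast
    linear_combination e1 - e2
  unfold jacobiUDeriv jacobiU weightedPolyDeriv weightedPoly
  linear_combination (jacobiW α β (k + 2) * halfWeight α β x *
      (jacobiPoly α β (k + 2)).eval (cos x)) * (hs - hd) -
    jacobiW α β (k + 2) * halfWeight α β x * hr' +
    halfWeight α β x * (jacobiPoly α β (k + 1)).eval (cos x) * hoff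

theorem hasDerivAt_jacobiU (α β : ℝ) (n : ℕ) {x : ℝ} (hx : x ∈ Ioo 0 π) :
    HasDerivAt (jacobiU α β n) (jacobiUDeriv α β n x) x :=
  (hasDerivAt_weightedPoly α β _ hx).const_mul _

theorem hasDerivAt_jacobiUDeriv {α β : ℝ} (h : -1 ≤ α + β) (k : ℕ) {x : ℝ} (hx : x ∈ Ioo 0 π) :
    HasDerivAt (jacobiUDeriv α β (k + 1))
      ((jacobiPot α β x - jacobiFreq α β (k + 1) ^ 2) * jacobiU α β (k + 1) x) x := by
  refine ((hasDerivAt_weightedPolyDeriv (jacobiPoly_ode h k) hx).const_mul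
    (jacobiW α β (k + 1))).congr_deriv ?_
  unfold jacobiU jacobiFreq
  push_cast
  ring

theorem continuous_jacobiU {α β : ℝ} (hα : -1 / 2 ≤ α) (hβ : -1 / 2 ≤ β) (n : ℕ) :
    Continuous (jacobiU α β n) :=
  (continuous_weightedPoly hα hβ _).const_mul _

theorem integral_jacobiU_mul_eq_zero {α β : ℝ} (hα : -1 / 2 ≤ α) (hβ : -1 / 2 ≤ β) {j k : ℕ}
    (hjk : j < k) : ∫ x in (0 : ℝ)..π, jacobiU α β (j + 1) x * jacobiU α β (k + 1) x = 0 := by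
  have hc : (j : ℝ) < k := by exact_mod_cast hjk
  have hj : (0 : ℝ) ≤ j := j.cast_nonneg
  have h := integral_weightedPoly_mul_eq_zero hα hβ
    (jacobiPoly_ode (α := α) (β := β) (by linarith) j)
    (jacobiPoly_ode (α := α) (β := β) (by linarith) k) (by
      have : ((j : ℝ) + 1) * (j + 2 + α + β) < (k + 1) * (k + 2 + α + β) := by nlinarith
      exact this.ne)
  unfold jacobiU
  calc _ = ∫ x in (0 : ℝ)..π, (jacobiW α β (j + 1) * jacobiW α β (k + 1)) *
        (weightedPoly α β (jacobiPoly α β (j + 1)) x *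
          weightedPoly α β (jacobiPoly α β (k + 1)) x) := by
        congr 1; funext x; ring
    _ = 0 := by rw [intervalIntegral.integral_const_mul, h, mul_zero]

/-- Subtracting the lowering relation from the raising relation at the same index removes the
derivative. -/
theorem cos_mul_jacobiU {α β : ℝ} (hα : -1 / 2 ≤ α) (hβ : -1 / 2 ≤ β) (k : ℕ)
    {x : ℝ} (hx : x ∈ Ioo 0 π) :
    2 * (cos x * jacobiU α β (k + 2) x) =
      (jacobiDiag α β (k + 1) + jacobiDiag α β k) / jacobiFreq α β (k + 2) *
        jacobiU α β (k + 2) x +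
      jacobiOffDiag α β (k + 1) * jacobiU α β (k + 3) x +
      jacobiOffDiag α β k * jacobiU α β (k + 1) x := by
  have h1 := jacobiFreq_pos (α := α) (β := β) (by linarith) (k + 1)
  have hR := sin_mul_jacobiUDeriv_raising hα hβ (k + 1) hx
  have hL := sin_mul_jacobiUDeriv_lowering hα hβ k hx
  have e : k + 1 + 1 = k + 2 := rfl
  have e' : k + 1 + 2 = k + 3 := rfl
  rw [e] at h1 hR
  rw [e'] at hR
  field_simp
  linear_combination hR - hL

/-- The integral of 2 cos x · u_{k+2} u_{k+3} is computed by applying the recurrence to either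
factor. By orthogonality each way leaves the same off-diagonal coefficient times one of the two
squared norms. -/
theorem integral_jacobiU_sq_succ {α β : ℝ} (hα : -1 / 2 ≤ α) (hβ : -1 / 2 ≤ β) (k : ℕ) :
    ∫ x in (0 : ℝ)..π, jacobiU α β (k + 3) x ^ 2 = ∫ x in (0 : ℝ)..π, jacobiU α β (k + 2) x ^ 2 := by
  have hc := continuous_jacobiU hα hβ
  have hI : ∀ i j : ℕ, IntervalIntegrable (fun x => jacobiU α β i x * jacobiU α β j x)
      MeasureTheory.volume 0 π := fun i j => ((hc i).mul (hc j)).intervalIntegrable _ _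
  have ha : ∫ x in (0 : ℝ)..π, 2 * (cos x * jacobiU α β (k + 2) x) * jacobiU α β (k + 3) x =
      jacobiOffDiag α β (k + 1) * ∫ x in (0 : ℝ)..π, jacobiU α β (k + 3) x ^ 2 := by
    calc _ = ∫ x in (0 : ℝ)..π, ((jacobiDiag α β (k + 1) + jacobiDiag α β k) /
          jacobiFreq α β (k + 2) * (jacobiU α β (k + 2) x * jacobiU α β (k + 3) x) +
          jacobiOffDiag α β (k + 1) * (jacobiU α β (k + 3) x * jacobiU α β (k + 3) x)) +
          jacobiOffDiag α β k * (jacobiU α β (k + 1) x * jacobiU α β (k + 3) x) := by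
          refine integral_congr_Ioo_of_le pi_pos.le fun x hx => ?_
          rw [cos_mul_jacobiU hα hβ k hx]
          ring
      _ = _ := by
          rw [integral_add (((hI _ _).const_mul _).add ((hI _ _).const_mul _))
            ((hI _ _).const_mul _), integral_add ((hI _ _).const_mul _) ((hI _ _).const_mul _)]
          simp only [intervalIntegral.integral_const_mul]
          rw [integral_jacobiU_mul_eq_zero hα hβ (Nat.lt_succ_self (k + 1)),
            integral_jacobiU_mul_eq_zero hα hβ (by omega : k < k + 2)]
          simp only [sq]
          ring
  have hb : ∫ x in (0 : ℝ)..π, 2 * (cos x * jacobiU α β (k + 2) x) * jacobiU α β (k + 3) x =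
      jacobiOffDiag α β (k + 1) * ∫ x in (0 : ℝ)..π, jacobiU α β (k + 2) x ^ 2 := by
    calc _ = ∫ x in (0 : ℝ)..π, ((jacobiDiag α β (k + 2) + jacobiDiag α β (k + 1)) /
          jacobiFreq α β (k + 3) * (jacobiU α β (k + 2) x * jacobiU α β (k + 3) x) +
          jacobiOffDiag α β (k + 2) * (jacobiU α β (k + 2) x * jacobiU α β (k + 4) x)) +
          jacobiOffDiag α β (k + 1) * (jacobiU α β (k + 2) x * jacobiU α β (k + 2) x) := by
          refine integral_congr_Ioo_of_le pi_pos.le fun x hx => ?_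
          have := cos_mul_jacobiU hα hβ (k + 1) hx
          linear_combination jacobiU α β (k + 2) x * this
      _ = _ := by
          rw [integral_add (((hI _ _).const_mul _).add ((hI _ _).const_mul _))
            ((hI _ _).const_mul _), integral_add ((hI _ _).const_mul _) ((hI _ _).const_mul _)]
          simp only [intervalIntegral.integral_const_mul]
          rw [integral_jacobiU_mul_eq_zero hα hβ (Nat.lt_succ_self (k + 1)),
            integral_jacobiU_mul_eq_zero hα hβ (by omega : k + 1 < k + 3)]
          simp only [sq]
          ring
  exact mul_left_cancel₀ (jacobiOffDiag_pos hα hβ (k + 1)).ne' (ha.symm.trans hb)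

/-- Only boundedness of the norms is needed, so their common value is not computed. Index 1 enters
the bound separately because the recurrence is available from index 2 on. -/
theorem exists_integral_jacobiU_sq_le {α β : ℝ} (hα : -1 / 2 ≤ α) (hβ : -1 / 2 ≤ β) :
    ∃ H : ℝ, 0 ≤ H ∧ ∀ k : ℕ, ∫ x in (0 : ℝ)..π, jacobiU α β (k + 1) x ^ 2 ≤ H := by
  have hn : ∀ n, 0 ≤ ∫ x in (0 : ℝ)..π, jacobiU α β n x ^ 2 := fun n =>
    integral_nonneg pi_pos.le fun x _ => sq_nonneg _
  have hs : ∀ k : ℕ, ∫ x in (0 : ℝ)..π, jacobiU α β (k + 2) x ^ 2 =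
      ∫ x in (0 : ℝ)..π, jacobiU α β 2 x ^ 2 := by
    intro k
    induction k with
    | zero => rfl
    | succ k ih => rw [← ih]; exact integral_jacobiU_sq_succ hα hβ k
  refine ⟨_, add_nonneg (hn 1) (hn 2), fun k => ?_⟩
  cases k with
  | zero => exact le_add_of_nonneg_right (hn 2)
  | succ k => exact (hs k).trans_le (le_add_of_nonneg_left (hn 1))

/-- The sum of the two ladder relations at index k + 2 has no cosine term. What remains besides the
derivative is the deviation of the off-diagonal coefficients from 1 and a difference of diagonal
ones divided by the frequency, all O(k⁻²). -/
theorem abs_jacobiU_sub_sub_le {α β : ℝ} (hα : -1 / 2 ≤ α) (hβ : -1 / 2 ≤ β) :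
    ∃ C : ℝ, 0 ≤ C ∧ ∀ (k : ℕ) (x B : ℝ), x ∈ Ioo 0 π → (∀ n, |jacobiU α β (n + 1) x| ≤ B) →
      |jacobiU α β (k + 3) x - jacobiU α β (k + 1) x -
        2 / jacobiFreq α β (k + 2) * (sin x * jacobiUDeriv α β (k + 2) x)| ≤
        C * B / ((k : ℝ) + 1) ^ 2 := by
  set c := 1 + (α + β) ^ 2 + (α - β) ^ 2 + (α + β) ^ 2 * (α - β) ^ 2 with hc
  refine ⟨2 * c + |β ^ 2 - α ^ 2|, by positivity, fun k x B hx hB => ?_⟩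
  have hk : (0 : ℝ) ≤ k := k.cast_nonneg
  have h1 := jacobiFreq_ge (α := α) (β := β) (by linarith) (k + 2)
  push_cast at h1
  have hpos : 0 < jacobiFreq α β (k + 2) := by linarith
  have hR := sin_mul_jacobiUDeriv_raising hα hβ (k + 1) hx
  have hL := sin_mul_jacobiUDeriv_lowering hα hβ k hx
  have e : k + 1 + 1 = k + 2 := rfl
  have e' : k + 1 + 2 = k + 3 := rfl
  rw [e, e'] at hR
  have hB0 : 0 ≤ B := (abs_nonneg _).trans (hB 0)
  have key : jacobiU α β (k + 3) x - jacobiU α β (k + 1) x -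
        2 / jacobiFreq α β (k + 2) * (sin x * jacobiUDeriv α β (k + 2) x) =
      -(jacobiOffDiag α β (k + 1) - 1) * jacobiU α β (k + 3) x +
      (jacobiOffDiag α β k - 1) * jacobiU α β (k + 1) x -
      (jacobiDiag α β (k + 1) - jacobiDiag α β k) / jacobiFreq α β (k + 2) *
        jacobiU α β (k + 2) x := by
    field_simp
    linear_combination -hR - hL
  have o1 := abs_jacobiOffDiag_sub_one_le hα hβ (k + 1)
  have o2 := abs_jacobiOffDiag_sub_one_le hα hβ k
  rw [← hc] at o1 o2
  have hc0 : 0 ≤ c := by positivity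
  have o1' : |jacobiOffDiag α β (k + 1) - 1| ≤ c / ((k : ℝ) + 1) ^ 2 := by
    refine o1.trans ?_
    push_cast
    gcongr
    linarith
  have hdiag : ∀ j : ℕ, |jacobiDiag α β j| ≤ |β ^ 2 - α ^ 2| / (2 * ((j : ℝ) + 1)) := by
    intro j
    have hj : (0 : ℝ) ≤ j := j.cast_nonneg
    unfold jacobiDiag
    rw [abs_div, abs_of_pos (by linarith : 0 < 2 * (α + β + 2 * j + 4))]
    exact div_le_div_of_nonneg_left (abs_nonneg _) (by linarith) (by linarith)
  have o3 : |(jacobiDiag α β (k + 1) - jacobiDiag α β k) / jacobiFreq α β (k + 2)| ≤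
      |β ^ 2 - α ^ 2| / ((k : ℝ) + 1) ^ 2 := by
    have d1 := hdiag (k + 1)
    have d2 := hdiag k
    push_cast at d1
    have d3 : |β ^ 2 - α ^ 2| / (2 * ((k : ℝ) + 1 + 1)) ≤
        |β ^ 2 - α ^ 2| / (2 * ((k : ℝ) + 1)) := by
      gcongr
      linarith
    rw [abs_div, abs_of_pos hpos, sq ((k : ℝ) + 1), ← div_div]
    have d4 : |jacobiDiag α β (k + 1) - jacobiDiag α β k| ≤ |β ^ 2 - α ^ 2| / ((k : ℝ) + 1) := by
      refine (abs_sub _ _).trans ?_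
      have : |β ^ 2 - α ^ 2| / ((k : ℝ) + 1) = |β ^ 2 - α ^ 2| / (2 * ((k : ℝ) + 1)) +
        |β ^ 2 - α ^ 2| / (2 * ((k : ℝ) + 1)) := by field_simp; norm_num
      linarith
    gcongr
    linarith
  rw [key]
  refine (abs_sub _ _).trans ?_
  refine (add_le_add_left (abs_add_le _ _) _).trans ?_
  rw [abs_mul, abs_mul, abs_mul, abs_neg]
  calc _ ≤ c / ((k : ℝ) + 1) ^ 2 * B + c / ((k : ℝ) + 1) ^ 2 * B +
      |β ^ 2 - α ^ 2| / ((k : ℝ) + 1) ^ 2 * B := by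
        gcongr
        · exact hB (k + 2)
        · exact hB k
        · exact hB (k + 1)
    _ = _ := by ring

/-! ### Behaviour near the endpoints. -/

theorem halfWeight_pos (α β : ℝ) {x : ℝ} (hx : x ∈ Ioo 0 π) : 0 < halfWeight α β x :=
  mul_pos (rpow_pos_of_pos (sin_half_pos hx) _) (rpow_pos_of_pos (cos_half_pos hx) _)

theorem halfWeight_nonneg (α β : ℝ) {x : ℝ} (hx : x ∈ Icc 0 π) : 0 ≤ halfWeight α β x :=
  mul_nonneg (rpow_nonneg (sin_nonneg_of_nonneg_of_le_pi (by linarith [hx.1])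
    (by linarith [hx.2, hx.1])) _)
    (rpow_nonneg (cos_nonneg_of_neg_pi_div_two_le_of_le (by linarith [hx.1, pi_pos])
      (by linarith [hx.2])) _)

/-- The sine factor increases, and the cosine factor loses at most a constant because cos(x/2) ≥ 1/2
on this range. -/
theorem halfWeight_le {α β : ℝ} (hα : -1 / 2 ≤ α) (hβ : -1 / 2 ≤ β) {t x : ℝ} (ht : 0 ≤ t)
    (htx : t ≤ x) (hx : x ≤ π / 2) :
    halfWeight α β t ≤ 2 ^ (β + 1 / 2) * halfWeight α β x := by
  have hpi := pi_pos
  have hs : sin (t / 2) ≤ sin (x / 2) :=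
    sin_le_sin_of_le_of_le_pi_div_two (by linarith) (by linarith) (by linarith)
  have hs0 : 0 ≤ sin (t / 2) := sin_nonneg_of_nonneg_of_le_pi (by linarith) (by linarith)
  have hc : 1 / 2 ≤ cos (x / 2) := by
    rw [← cos_pi_div_three]
    exact cos_le_cos_of_nonneg_of_le_pi (by linarith) (by linarith) (by linarith)
  have hc0 : 0 ≤ cos (t / 2) :=
    cos_nonneg_of_neg_pi_div_two_le_of_le (by linarith) (by linarith)
  have h1 : sin (t / 2) ^ (α + 1 / 2) ≤ sin (x / 2) ^ (α + 1 / 2) :=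
    rpow_le_rpow hs0 hs (by linarith)
  have h2 : cos (t / 2) ^ (β + 1 / 2) ≤ 2 ^ (β + 1 / 2) * cos (x / 2) ^ (β + 1 / 2) := by
    rw [← mul_rpow (by norm_num) (by linarith)]
    exact rpow_le_rpow hc0 (by linarith [cos_le_one (t / 2)]) (by linarith)
  unfold halfWeight
  calc _ ≤ sin (x / 2) ^ (α + 1 / 2) * (2 ^ (β + 1 / 2) * cos (x / 2) ^ (β + 1 / 2)) :=
        mul_le_mul h1 h2 (rpow_nonneg hc0 _) (rpow_nonneg (hs0.trans hs) _)
    _ = _ := by ring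

/-- This is the self-adjoint (Sturm–Liouville) form (ψ² y')' = -λψ² y for y = Q(cos x) and ψ the
half-angle weight. -/
theorem weighted_flux_hasDerivAt {α β lam : ℝ} {Q : Polynomial ℝ} (hQ : JacobiODE α β lam Q)
    {x : ℝ} (hx : x ∈ Ioo 0 π) :
    HasDerivAt (fun t => halfWeight α β t ^ 2 * -(sin t * Q.derivative.eval (cos t)))
      (-lam * halfWeight α β x ^ 2 * Q.eval (cos x)) x := by
  have e := ((hasDerivAt_halfWeight α β hx).pow 2).mul
    ((hasDerivAt_sin x).mul (hasDerivAt_eval_cos Q.derivative x)).neg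
  refine e.congr_deriv ?_
  have ho := hQ (cos x)
  rw [show 1 - cos x ^ 2 = sin x ^ 2 by linarith [sin_sq_add_cos_sq x]] at ho
  have h1 := sin_mul_halfWeightLog α β hx
  simp only [Pi.mul_apply, Pi.pow_apply, Pi.neg_apply]
  push_cast
  linear_combination halfWeight α β x ^ 2 * ho -
    2 * halfWeight α β x ^ 2 * Q.derivative.eval (cos x) * h1

theorem abs_sin_mul_halfWeightLog_le {α β : ℝ} (h : -1 ≤ α + β) {x : ℝ} (hx : x ∈ Ioo 0 π) :
    |sin x * halfWeightLog α β x| ≤ (α + β + 1) / 2 + |α - β| / 2 := by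
  rw [sin_mul_halfWeightLog α β hx]
  refine (abs_add_le _ _).trans ?_
  rw [abs_mul, abs_of_nonneg (by linarith : 0 ≤ (α + β + 1) / 2), abs_div (α - β),
    abs_of_pos (two_pos : (0 : ℝ) < 2)]
  have := abs_cos_le_one x
  have : (α + β + 1) / 2 * |cos x| ≤ (α + β + 1) / 2 :=
    mul_le_of_le_one_right (by linarith) this
  linarith

/-- Near the left endpoint a solution is controlled by its value at the end of a short interval. -/
theorem weightedPoly_near_zero {α β lam C x₀ : ℝ} (hα : -1 / 2 ≤ α) (hβ : -1 / 2 ≤ β)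
    {Q : Polynomial ℝ} (hQ : JacobiODE α β lam Q) (hlam : 0 ≤ lam)
    (hC : (2 : ℝ) ^ (β + 1 / 2) ≤ C) (hx₀ : 0 < x₀) (hx₀' : x₀ ≤ π / 2)
    (hsmall : lam * C ^ 2 * x₀ ^ 2 ≤ 1 / 2) {x : ℝ} (hx : x ∈ Ioc 0 x₀) :
    |weightedPoly α β Q x| ≤ 2 * C * |weightedPoly α β Q x₀| ∧
    |sin x * weightedPolyDeriv α β Q x| ≤
      (α + β + 1 + |α - β| + 1) * C * |weightedPoly α β Q x₀| := by
  have hpi := pi_pos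
  have hC0 : 0 ≤ C := (rpow_nonneg (by norm_num) _).trans hC
  have hw : ∀ {t x : ℝ}, 0 ≤ t → t ≤ x → x ≤ π / 2 →
      halfWeight α β t ≤ C * halfWeight α β x := by
    intro t x h1 h2 h3
    exact (halfWeight_le hα hβ h1 h2 h3).trans (mul_le_mul_of_nonneg_right hC
      (halfWeight_nonneg α β ⟨h1.trans h2, by linarith⟩))
  obtain ⟨xm, hxm, hmax⟩ := isCompact_Icc.exists_isMaxOn (nonempty_Icc.mpr hx₀.le)
    (continuous_eval_cos Q).abs.continuousOn
  set S := |Q.eval (cos xm)| with hS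
  have hS0 : 0 ≤ S := abs_nonneg _
  have hSle : ∀ t ∈ Icc 0 x₀, |Q.eval (cos t)| ≤ S := fun t ht => hmax ht
  -- The flux vanishes at 0, so the mean value theorem on [0,x] bounds it by λψ(c)²Sx;
  -- near-monotonicity of ψ then allows division by ψ(x)².
  have hderiv : ∀ x ∈ Icc 0 x₀, |sin x * Q.derivative.eval (cos x)| ≤ lam * C ^ 2 * S * x := by
    intro x hx
    rcases hx.1.eq_or_lt with h0 | h0
    · rw [← h0]; simp
    have hxI : x ∈ Ioo 0 π := ⟨h0, by linarith [hx.2]⟩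
    have hcont : Continuous fun t => halfWeight α β t ^ 2 * -(sin t * Q.derivative.eval (cos t)) :=
      ((continuous_halfWeight hα hβ).pow 2).mul
        (continuous_sin.mul (continuous_eval_cos Q.derivative)).neg
    obtain ⟨c, hc, he⟩ := exists_hasDerivAt_eq_slope _ _ h0 hcont.continuousOn
      (fun t ht => weighted_flux_hasDerivAt (x := t) hQ ⟨ht.1, ht.2.trans hxI.2⟩)
    have hψ := halfWeight_pos α β hxI
    have hcw := hw hc.1.le hc.2.le (hx.2.trans hx₀')
    have hcw0 := halfWeight_nonneg α β (x := c) ⟨hc.1.le, by linarith [hc.2, hxI.2]⟩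
    simp only [sin_zero, zero_mul, neg_zero, mul_zero, sub_zero] at he
    rw [eq_div_iff h0.ne'] at he
    have h1 : halfWeight α β x ^ 2 * |sin x * Q.derivative.eval (cos x)| =
        lam * halfWeight α β c ^ 2 * |Q.eval (cos c)| * x := by
      have := congrArg abs he
      rw [abs_mul, abs_mul, abs_mul, abs_mul, abs_neg, abs_neg, abs_of_nonneg hlam,
        abs_of_pos h0, abs_of_nonneg (sq_nonneg (halfWeight α β c)),
        abs_of_nonneg (sq_nonneg (halfWeight α β x))] at this
      exact this.symm
    have h2 : halfWeight α β c ^ 2 ≤ C ^ 2 * halfWeight α β x ^ 2 := by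
      rw [← mul_pow]
      exact pow_le_pow_left₀ hcw0 hcw 2
    refine le_of_mul_le_mul_left ?_ (pow_pos hψ 2)
    rw [h1]
    calc lam * halfWeight α β c ^ 2 * |Q.eval (cos c)| * x
        ≤ lam * (C ^ 2 * halfWeight α β x ^ 2) * S * x := by
          gcongr
          exact hSle c ⟨hc.1.le, hc.2.le.trans hx.2⟩
      _ = _ := by ring
  -- By the smallness condition Q(cos ·) varies by at most S/2 on [0,x₀], so its value at x₀ is at
  -- least half the maximum.
  have hSx₀ : S ≤ 2 * |Q.eval (cos x₀)| := by
    have hb : ∀ t ∈ Icc 0 x₀, ‖-(sin t * Q.derivative.eval (cos t))‖ ≤ lam * C ^ 2 * S * x₀ := by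
      intro t ht
      rw [norm_eq_abs, abs_neg]
      refine (hderiv t ht).trans ?_
      have := ht.2
      gcongr
    have h := (convex_Icc 0 x₀).norm_image_sub_le_of_norm_hasDerivWithin_le
      (fun t _ => (hasDerivAt_eval_cos Q t).hasDerivWithinAt) hb
      (right_mem_Icc.mpr hx₀.le) hxm
    rw [norm_eq_abs, norm_eq_abs] at h
    have h3 : |xm - x₀| ≤ x₀ := by
      rw [abs_le]; constructor <;> linarith [hxm.1, hxm.2]
    have h4 : |Q.eval (cos xm) - Q.eval (cos x₀)| ≤ S / 2 := by
      refine h.trans ?_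
      calc lam * C ^ 2 * S * x₀ * |xm - x₀| ≤ lam * C ^ 2 * S * x₀ * x₀ := by gcongr
        _ = S * (lam * C ^ 2 * x₀ ^ 2) := by ring
        _ ≤ S * (1 / 2) := by gcongr
        _ = S / 2 := by ring
    have h5 := abs_sub_abs_le_abs_sub (Q.eval (cos xm)) (Q.eval (cos x₀))
    linarith
  have hxI : x ∈ Ioo 0 π := ⟨hx.1, by linarith [hx.2]⟩
  have hxI₀ : x₀ ∈ Ioo 0 π := ⟨hx₀, by linarith⟩
  have hψ := halfWeight_pos α β hxI
  have hψ₀ := halfWeight_pos α β hxI₀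
  have hwx := hw hx.1.le hx.2 hx₀'
  have hval : |weightedPoly α β Q x₀| = halfWeight α β x₀ * |Q.eval (cos x₀)| := by
    unfold weightedPoly
    rw [abs_mul, abs_of_pos hψ₀]
  have hψS : halfWeight α β x * S ≤ 2 * C * |weightedPoly α β Q x₀| := by
    rw [hval]
    calc _ ≤ (C * halfWeight α β x₀) * (2 * |Q.eval (cos x₀)|) := by gcongr
      _ = _ := by ring
  constructor
  · refine le_trans ?_ hψS
    unfold weightedPoly
    rw [abs_mul, abs_of_pos hψ]
    have := hSle x ⟨hx.1.le, hx.2⟩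
    gcongr
  · have e : sin x * weightedPolyDeriv α β Q x = halfWeight α β x *
        (sin x * halfWeightLog α β x * Q.eval (cos x) -
          sin x * (sin x * Q.derivative.eval (cos x))) := by
      unfold weightedPolyDeriv
      ring
    have h1 : |sin x * halfWeightLog α β x * Q.eval (cos x)| ≤
        ((α + β + 1) / 2 + |α - β| / 2) * S := by
      rw [abs_mul]
      have h0 := abs_sin_mul_halfWeightLog_le (α := α) (β := β) (by linarith) hxI
      exact mul_le_mul h0 (hSle x ⟨hx.1.le, hx.2⟩) (abs_nonneg _) ((abs_nonneg _).trans h0)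
    have h2 : |sin x * (sin x * Q.derivative.eval (cos x))| ≤ 1 / 2 * S := by
      rw [abs_mul]
      have h0 : |sin x| ≤ x₀ := (abs_sin_le_abs).trans (by
        rw [abs_of_pos hx.1]; exact hx.2)
      calc |sin x| * |sin x * Q.derivative.eval (cos x)| ≤ x₀ * (lam * C ^ 2 * S * x₀) := by
            refine mul_le_mul h0 ((hderiv x ⟨hx.1.le, hx.2⟩).trans ?_) (abs_nonneg _) hx₀.le
            have := hx.2
            gcongr
        _ = lam * C ^ 2 * x₀ ^ 2 * S := by ring
        _ ≤ _ := by gcongr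
    rw [e, abs_mul, abs_of_pos hψ]
    calc _ ≤ halfWeight α β x * (((α + β + 1) / 2 + |α - β| / 2) * S + 1 / 2 * S) := by
          gcongr
          exact (abs_sub _ _).trans (add_le_add h1 h2)
      _ = (α + β + 1 + |α - β| + 1) / 2 * (halfWeight α β x * S) := by ring
      _ ≤ (α + β + 1 + |α - β| + 1) / 2 * (2 * C * |weightedPoly α β Q x₀|) := by
          have : 0 ≤ α + β + 1 + |α - β| + 1 := by linarith [abs_nonneg (α - β)]
          gcongr
      _ = _ := by ring

theorem JacobiODE.comp_neg {α β lam : ℝ} {Q : Polynomial ℝ} (hQ : JacobiODE α β lam Q) :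
    JacobiODE β α lam (Q.comp (-Polynomial.X)) := by
  intro z
  have := hQ (-z)
  simp only [Polynomial.derivative_comp, Polynomial.derivative_neg, Polynomial.derivative_X,
    Polynomial.derivative_mul, Polynomial.derivative_one, Polynomial.eval_mul,
    Polynomial.eval_add, Polynomial.eval_neg, Polynomial.eval_one, Polynomial.eval_comp,
    Polynomial.eval_X, neg_zero, Polynomial.eval_zero]
  linear_combination this

theorem halfWeight_pi_sub (α β x : ℝ) : halfWeight α β (π - x) = halfWeight β α x := by
  unfold halfWeight
  rw [show (π - x) / 2 = π / 2 - x / 2 by ring, sin_pi_div_two_sub, cos_pi_div_two_sub]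
  ring

theorem weightedPoly_pi_sub (α β : ℝ) (Q : Polynomial ℝ) (x : ℝ) :
    weightedPoly α β Q (π - x) = weightedPoly β α (Q.comp (-Polynomial.X)) x := by
  unfold weightedPoly
  rw [halfWeight_pi_sub, cos_pi_sub]
  simp

theorem weightedPolyDeriv_pi_sub (α β : ℝ) (Q : Polynomial ℝ) (x : ℝ) :
    weightedPolyDeriv α β Q (π - x) = -weightedPolyDeriv β α (Q.comp (-Polynomial.X)) x := by
  unfold weightedPolyDeriv
  rw [halfWeight_pi_sub, cos_pi_sub, sin_pi_sub]
  have : halfWeightLog α β (π - x) = -halfWeightLog β α x := by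
    unfold halfWeightLog
    rw [show (π - x) / 2 = π / 2 - x / 2 by ring, sin_pi_div_two_sub, cos_pi_div_two_sub]
    ring
  rw [this]
  simp [Polynomial.derivative_comp]
  ring

/-! ### Energy estimates and uniform bounds for the Jacobi functions. -/

theorem le_sin_of_mem_Icc {a x : ℝ} (ha : 0 ≤ a) (hx : x ∈ Icc a (π - a)) :
    2 / π * a ≤ sin x := by
  have hpi := pi_pos
  have hp : 0 ≤ 2 / π := by positivity
  rcases le_total x (π / 2) with h | h
  · refine le_trans ?_ (mul_le_sin (ha.trans hx.1) h)
    exact mul_le_mul_of_nonneg_left hx.1 hp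
  · rw [← sin_pi_sub]
    refine le_trans ?_ (mul_le_sin (x := π - x) (by linarith [hx.2]) (by linarith))
    exact mul_le_mul_of_nonneg_left (by linarith [hx.2]) hp

theorem hasDerivAt_cot {x : ℝ} (hx : sin x ≠ 0) :
    HasDerivAt (fun x => cos x / sin x) (-(1 / sin x ^ 2)) x := by
  refine ((hasDerivAt_cos x).div (hasDerivAt_sin x) hx).congr_deriv ?_
  rw [← neg_div]
  congr 1
  linarith [sin_sq_add_cos_sq x]

theorem abs_cot_le {a x : ℝ} (ha : 0 < a) (hx : x ∈ Icc a (π - a)) :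
    |cos x / sin x| ≤ π / (2 * a) := by
  have h := le_sin_of_mem_Icc ha.le hx
  have hpi := pi_pos
  have h0 : 0 < 2 / π * a := by positivity
  rw [abs_div, abs_of_pos (h0.trans_le h)]
  calc |cos x| / sin x ≤ 1 / (2 / π * a) := div_le_div₀ zero_le_one (abs_cos_le_one x) h0 h
    _ = _ := by field_simp

/-- The energy of a solution of `u'' = (V - N²) u` with `|V| ≤ K / sin²` is nearly constant. -/
theorem energy_le {u u' V : ℝ → ℝ} {N K a : ℝ} (hN : 0 < N) (ha : 0 < a)
    (hu : ∀ x ∈ Ioo 0 π, HasDerivAt u (u' x) x)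
    (hu' : ∀ x ∈ Ioo 0 π, HasDerivAt u' ((V x - N ^ 2) * u x) x)
    (hV : ∀ x ∈ Ioo 0 π, |V x| ≤ K / sin x ^ 2) {x t : ℝ} (hx : x ∈ Icc a (π - a))
    (ht : t ∈ Icc a (π - a)) :
    u' x ^ 2 + N ^ 2 * u x ^ 2 ≤
      exp (K * π / (N * a)) * (u' t ^ 2 + N ^ 2 * u t ^ 2) := by
  have hI : ∀ y ∈ Icc a (π - a), y ∈ Ioo 0 π := fun y hy =>
    ⟨ha.trans_le hy.1, by linarith [hy.2]⟩
  have hK : 0 ≤ K := by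
    have h0 := hI x hx
    have h1 := sin_pos_of_pos_of_lt_pi h0.1 h0.2
    have h2 := (abs_nonneg _).trans (hV x h0)
    by_contra hneg
    have := div_neg_of_neg_of_pos (not_le.mp hneg) (pow_pos h1 2)
    linarith
  set E : ℝ → ℝ := fun y => u' y ^ 2 + N ^ 2 * u y ^ 2 with hE
  have hE0 : ∀ y, 0 ≤ E y := fun y => by simp only [hE]; positivity
  have hEd : ∀ y ∈ Ioo 0 π, HasDerivAt E (2 * V y * u y * u' y) y := by
    intro y hy
    refine (((hu' y hy).pow 2).add (((hu y hy).pow 2).const_mul (N ^ 2))).congr_deriv ?_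
    push_cast
    ring
  have hEb : ∀ y ∈ Ioo 0 π, |2 * V y * u y * u' y| ≤ K / N * (1 / sin y ^ 2) * E y := by
    intro y hy
    have h1 : 2 * N * (|u y| * |u' y|) ≤ E y := by
      have := sq_nonneg (|u' y| - N * |u y|)
      have e1 := sq_abs (u' y)
      have e2 := sq_abs (u y)
      simp only [hE]
      rw [← e1, ← e2]
      linarith
    have h2 : |u y| * |u' y| * 2 ≤ E y / N := by
      rw [le_div_iff₀ hN]; linarith
    rw [abs_mul, abs_mul, abs_mul, abs_two]
    calc 2 * |V y| * |u y| * |u' y| = |V y| * (|u y| * |u' y| * 2) := by ring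
      _ ≤ K / sin y ^ 2 * (E y / N) := by
          have := hV y hy
          have h3 : 0 ≤ E y / N := div_nonneg (hE0 y) hN.le
          gcongr
      _ = _ := by ring
  have hsin : ∀ y ∈ Ioo 0 π, sin y ≠ 0 := fun y hy => (sin_pos_of_pos_of_lt_pi hy.1 hy.2).ne'
  -- A Grönwall argument in both directions: |E'| ≤ (K/N)E/sin² and cot' = -1/sin², so
  -- E·exp((K/N)cot) decreases and E·exp(-(K/N)cot) increases. The variation of cot on the interval
  -- is at most π/a.
  have key : ∀ s : ℝ, (s = 1 ∨ s = -1) → ∀ y ∈ Ioo 0 π,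
      HasDerivAt (fun y => E y * exp (s * (K / N) * (cos y / sin y)))
        ((2 * V y * u y * u' y - s * (K / N * (1 / sin y ^ 2) * E y)) *
          exp (s * (K / N) * (cos y / sin y))) y := by
    intro s _ y hy
    refine ((hEd y hy).mul (((hasDerivAt_cot (hsin y hy)).const_mul _).exp)).congr_deriv ?_
    ring
  have hcont : ∀ s : ℝ, (s = 1 ∨ s = -1) →
      ContinuousOn (fun y => E y * exp (s * (K / N) * (cos y / sin y))) (Icc a (π - a)) :=
    fun s hs y hy => (key s hs y (hI y hy)).continuousAt.continuousWithinAt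
  have hexp : ∀ s : ℝ, (s = 1 ∨ s = -1) →
      E x * exp (s * (K / N) * (cos x / sin x)) ≤ E t * exp (s * (K / N) * (cos t / sin t)) →
      E x ≤ exp (K * π / (N * a)) * E t := by
    intro s hs h
    have hc1 := abs_le.mp (abs_cot_le ha hx)
    have hc2 := abs_le.mp (abs_cot_le ha ht)
    have hKN : 0 ≤ K / N := div_nonneg hK hN.le
    have h1 : E x ≤ E t * exp (s * (K / N) * (cos t / sin t) - s * (K / N) * (cos x / sin x)) := by
      rw [exp_sub, ← mul_div_assoc, le_div_iff₀ (exp_pos _)]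
      exact h
    have h2 : s * (K / N) * (cos t / sin t) - s * (K / N) * (cos x / sin x) ≤
        K * π / (N * a) := by
      have e : K * π / (N * a) = K / N * (π / (2 * a) + π / (2 * a)) := by
        field_simp
        norm_num
      rw [e]
      rcases hs with rfl | rfl
      · have := mul_le_mul_of_nonneg_left (add_le_add hc2.2 (neg_le.mp hc1.1)) hKN
        linarith
      · have := mul_le_mul_of_nonneg_left (add_le_add hc1.2 (neg_le.mp hc2.1)) hKN
        linarith
    calc E x ≤ _ := h1
      _ ≤ E t * exp (K * π / (N * a)) := by
          have := hE0 t
          gcongr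
      _ = _ := mul_comm _ _
  have hint : ∀ y ∈ interior (Icc a (π - a)), y ∈ Ioo 0 π := fun y hy => hI y (interior_subset hy)
  rcases le_total x t with hxt | hxt
  · refine hexp (-1) (Or.inr rfl) ?_
    refine monotoneOn_of_deriv_nonneg (convex_Icc _ _) (hcont _ (Or.inr rfl))
      (fun y hy => (key _ (Or.inr rfl) y (hint y hy)).differentiableAt.differentiableWithinAt)
      (fun y hy => ?_) hx ht hxt
    rw [(key _ (Or.inr rfl) y (hint y hy)).deriv]
    have := (abs_le.mp (hEb y (hint y hy))).1
    exact mul_nonneg (by linarith) (exp_pos _).le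
  · refine hexp 1 (Or.inl rfl) ?_
    refine antitoneOn_of_deriv_nonpos (convex_Icc _ _) (hcont _ (Or.inl rfl))
      (fun y hy => (key _ (Or.inl rfl) y (hint y hy)).differentiableAt.differentiableWithinAt)
      (fun y hy => ?_) ht hx hxt
    rw [(key _ (Or.inl rfl) y (hint y hy)).deriv]
    have := (abs_le.mp (hEb y (hint y hy))).2
    exact mul_nonpos_of_nonpos_of_nonneg (by linarith) (exp_pos _).le

theorem abs_jacobiPot_le (α β : ℝ) {x : ℝ} (hx : x ∈ Ioo 0 π) :
    |jacobiPot α β x| ≤ (|α ^ 2 - 1 / 4| + |β ^ 2 - 1 / 4|) / sin x ^ 2 := by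
  have h1 := sin_half_pos hx
  have h2 := cos_half_pos hx
  have e : jacobiPot α β x = ((α ^ 2 - 1 / 4) * cos (x / 2) ^ 2 +
      (β ^ 2 - 1 / 4) * sin (x / 2) ^ 2) / sin x ^ 2 := by
    unfold jacobiPot
    rw [sin_eq_half x]
    field_simp
    ring
  rw [e, abs_div, abs_of_nonneg (sq_nonneg (sin x))]
  gcongr
  refine (abs_add_le _ _).trans ?_
  rw [abs_mul, abs_mul, abs_of_nonneg (sq_nonneg (cos (x / 2))),
    abs_of_nonneg (sq_nonneg (sin (x / 2)))]
  exact add_le_add (mul_le_of_le_one_right (abs_nonneg _) (cos_sq_le_one _))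
    (mul_le_of_le_one_right (abs_nonneg _) (sin_sq_le_one _))

/-- Away from the ends the raising relation expresses the derivative through two consecutive
functions, so the energy is bounded by quantities whose integrals are known. -/
theorem exists_energy_le_jacobiU_sq {α β : ℝ} (hα : -1 / 2 ≤ α) (hβ : -1 / 2 ≤ β) :
    ∃ D : ℝ, 0 ≤ D ∧ ∀ (k : ℕ) (x : ℝ), x ∈ Ioo 0 π → 1 / 2 ≤ sin x →
      jacobiUDeriv α β (k + 1) x ^ 2 + jacobiFreq α β (k + 1) ^ 2 * jacobiU α β (k + 1) x ^ 2 ≤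
        D * jacobiFreq α β (k + 1) ^ 2 *
          (jacobiU α β (k + 1) x ^ 2 + jacobiU α β (k + 2) x ^ 2) := by
  set c := 1 + (α + β) ^ 2 + (α - β) ^ 2 + (α + β) ^ 2 * (α - β) ^ 2 with hc
  have hc0 : 0 ≤ c := by positivity
  set b := |β ^ 2 - α ^ 2| with hb
  have hb0 : 0 ≤ b := abs_nonneg _
  -- Each 8 is 4 from 1/sin² ≤ 4 times 2 from (p+q)² ≤ 2p² + 2q²; the 1 accounts for the term N²u².
  refine ⟨8 * (1 + b) ^ 2 + 1 + 8 * (1 + c) ^ 2, by positivity, fun k x hx hs => ?_⟩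
  have hk : (0 : ℝ) ≤ k := k.cast_nonneg
  have hN := jacobiFreq_ge (α := α) (β := β) (by linarith) (k + 1)
  push_cast at hN
  have hR := sin_mul_jacobiUDeriv_raising hα hβ k hx
  have he : |jacobiOffDiag α β k| ≤ 1 + c := by
    have h1 := abs_jacobiOffDiag_sub_one_le hα hβ k
    rw [← hc] at h1
    have h2 : c / ((k : ℝ) + 1) ^ 2 ≤ c := div_le_self hc0 (one_le_pow₀ (by linarith))
    have h3 := abs_sub_abs_le_abs_sub (jacobiOffDiag α β k) 1
    rw [abs_one] at h3
    linarith
  have hd : |jacobiDiag α β k| ≤ b := by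
    unfold jacobiDiag
    rw [abs_div]
    exact div_le_self hb0 (le_abs.mpr (Or.inl (by linarith)))
  set N := jacobiFreq α β (k + 1)
  have hN0 : 0 ≤ N := by linarith
  set u := jacobiU α β (k + 1) x
  set v := jacobiU α β (k + 2) x
  set w := jacobiUDeriv α β (k + 1) x
  have h1 : |sin x * w| ≤ N * ((1 + b) * |u| + (1 + c) * |v|) := by
    rw [hR]
    refine (abs_add_le _ _).trans ((add_le_add_left (abs_add_le _ _) _).trans ?_)
    rw [abs_mul, abs_mul, abs_mul, abs_mul, abs_mul, abs_neg, abs_of_pos (by linarith : 0 < N)]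
    have hcos := abs_cos_le_one x
    calc N * |cos x| * |u| + |jacobiDiag α β k| * |u| + N * |jacobiOffDiag α β k| * |v|
        ≤ N * 1 * |u| + (N * b) * |u| + N * (1 + c) * |v| := by
          gcongr
          · exact hd.trans (le_mul_of_one_le_left hb0 (by linarith))
      _ = _ := by ring
  have h2 : (sin x * w) ^ 2 ≤ N ^ 2 * (2 * (1 + b) ^ 2 * u ^ 2 + 2 * (1 + c) ^ 2 * v ^ 2) := by
    rw [← sq_abs (sin x * w)]
    refine (pow_le_pow_left₀ (abs_nonneg _) h1 2).trans ?_
    rw [mul_pow, ← sq_abs u, ← sq_abs v]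
    refine mul_le_mul_of_nonneg_left ?_ (sq_nonneg N)
    have := sq_nonneg ((1 + b) * |u| - (1 + c) * |v|)
    linarith
  have h3 : w ^ 2 ≤ 4 * (sin x * w) ^ 2 := by
    rw [mul_pow, ← mul_assoc]
    refine le_mul_of_one_le_left (sq_nonneg w) ?_
    have := pow_le_pow_left₀ (by norm_num) hs 2
    linarith
  have p1 : 0 ≤ N ^ 2 * u ^ 2 := by positivity
  have p2 : 0 ≤ N ^ 2 * v ^ 2 := by positivity
  have p3 := mul_nonneg (sq_nonneg (1 + b)) p2
  have p4 := mul_nonneg (sq_nonneg (1 + c)) p1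
  linarith

/-- The cut-off a is a small multiple of 1/N, which makes the smallness condition of
`weightedPoly_near_zero` hold since the eigenvalue is at most N². The right end follows from the
left by x ↦ π - x, which exchanges α and β; 2^(α+β+1) dominates the weight constants of both ends.
-/
theorem abs_jacobiU_ends_le {α β : ℝ} (hα : -1 / 2 ≤ α) (hβ : -1 / 2 ≤ β) (k : ℕ) {a G : ℝ}
    (ha : a = 1 / (2 * 2 ^ (α + β + 1) * jacobiFreq α β (k + 1)))
    (hG : ∀ x ∈ Icc a (π - a), |jacobiU α β (k + 1) x| ≤ G) {x : ℝ} (hx : x ∈ Ioo 0 π)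
    (hxa : x ∉ Icc a (π - a)) :
    |jacobiU α β (k + 1) x| ≤ 2 * 2 ^ (α + β + 1) * G ∧
    |sin x * jacobiUDeriv α β (k + 1) x| ≤
      (α + β + 1 + |α - β| + 1) * 2 ^ (α + β + 1) * G := by
  set C : ℝ := 2 ^ (α + β + 1) with hC
  have hC1 : 1 ≤ C := one_le_rpow (by norm_num) (by linarith)
  have hCα : (2 : ℝ) ^ (α + 1 / 2) ≤ C := rpow_le_rpow_of_exponent_le (by norm_num) (by linarith)
  have hCβ : (2 : ℝ) ^ (β + 1 / 2) ≤ C := rpow_le_rpow_of_exponent_le (by norm_num) (by linarith)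
  have hk : (0 : ℝ) ≤ k := k.cast_nonneg
  have hN := jacobiFreq_ge (α := α) (β := β) (by linarith) (k + 1)
  push_cast at hN
  have hpi := pi_gt_three
  set N := jacobiFreq α β (k + 1) with hNdef
  have hN1 : 1 ≤ N := by linarith
  have ha0 : 0 < a := by rw [ha]; positivity
  have ha1 : a ≤ 1 / 2 := by
    rw [ha]
    have : 1 ≤ C * N := one_le_mul_of_one_le_of_one_le hC1 hN1
    exact one_div_le_one_div_of_le two_pos (by linarith)
  have hlam0 : 0 ≤ ((k : ℝ) + 1) * (k + 2 + α + β) := mul_nonneg (by linarith) (by linarith)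
  have hlam : ((k : ℝ) + 1) * (k + 2 + α + β) ≤ N ^ 2 := by
    have : N ^ 2 = ((k : ℝ) + 1) * (k + 2 + α + β) + (α + β + 1) ^ 2 / 4 := by
      rw [hNdef]; unfold jacobiFreq; push_cast; ring
    linarith [sq_nonneg (α + β + 1)]
  have hsmall : ((k : ℝ) + 1) * (k + 2 + α + β) * C ^ 2 * a ^ 2 ≤ 1 / 2 := by
    calc _ ≤ N ^ 2 * C ^ 2 * a ^ 2 := by gcongr
      _ = 1 / 4 := by rw [ha]; field_simp; norm_num
      _ ≤ _ := by norm_num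
  have hode := jacobiPoly_ode (α := α) (β := β) (by linarith) k
  have hscale : ∀ {p q T : ℝ}, 0 ≤ T → |p| ≤ T * |q| → |jacobiW α β (k + 1) * q| ≤ G →
      |jacobiW α β (k + 1) * p| ≤ T * G := by
    intro p q T hT h1 h2
    rw [abs_mul] at h2 ⊢
    calc _ ≤ |jacobiW α β (k + 1)| * (T * |q|) := by gcongr
      _ = T * (|jacobiW α β (k + 1)| * |q|) := by ring
      _ ≤ T * G := by gcongr
  have hT1 : 0 ≤ 2 * C := by linarith
  have hT2 : 0 ≤ (α + β + 1 + |α - β| + 1) * C :=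
    mul_nonneg (by linarith [abs_nonneg (α - β)]) (by linarith)
  rcases lt_or_ge x a with hlt | hge
  · obtain ⟨h1, h2⟩ := weightedPoly_near_zero hα hβ hode hlam0 hCβ ha0 (by linarith) hsmall
      ⟨hx.1, hlt.le⟩
    have hGa := hG a ⟨le_rfl, by linarith⟩
    refine ⟨hscale hT1 h1 hGa, ?_⟩
    have := hscale hT2 h2 hGa
    rwa [mul_left_comm] at this
  · have hgt : π - a < x := by
      by_contra h
      exact hxa ⟨hge, not_lt.mp h⟩
    obtain ⟨h1, h2⟩ := weightedPoly_near_zero (x := π - x) hβ hα hode.comp_neg hlam0 hCα ha0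
      (by linarith) hsmall ⟨by linarith [hx.2], by linarith⟩
    have hGa := hG (π - a) ⟨by linarith, le_rfl⟩
    have e1 : ∀ y, weightedPoly β α ((jacobiPoly α β (k + 1)).comp (-Polynomial.X)) y =
        weightedPoly α β (jacobiPoly α β (k + 1)) (π - y) :=
      fun y => (weightedPoly_pi_sub α β _ y).symm
    have e2 : ∀ y, weightedPolyDeriv β α ((jacobiPoly α β (k + 1)).comp (-Polynomial.X)) y =
        -weightedPolyDeriv α β (jacobiPoly α β (k + 1)) (π - y) := by
      intro y
      rw [weightedPolyDeriv_pi_sub, neg_neg]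
    rw [e1, e1, sub_sub_cancel] at h1
    rw [e2, e1, sub_sub_cancel, sin_pi_sub, mul_neg, abs_neg, abs_sub_comm β α,
      add_comm β α] at h2
    refine ⟨hscale hT1 h1 hGa, ?_⟩
    have := hscale hT2 h2 hGa
    rwa [mul_left_comm] at this

/-- The energy at a point of [a,π-a] is compared with its values on [π/4,3π/4], averaged there and
bounded by L² norms; the remaining end intervals inherit the bound from the points a and π - a. -/
theorem exists_jacobiU_bound {α β : ℝ} (hα : -1 / 2 ≤ α) (hβ : -1 / 2 ≤ β) :
    ∃ B : ℝ, 1 ≤ B ∧ ∀ (k : ℕ), ∀ x ∈ Ioo 0 π, |jacobiU α β (k + 1) x| ≤ B ∧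
      |jacobiUDeriv α β (k + 1) x| ≤ B * ((k : ℝ) + 1 + 1 / sin x) := by
  obtain ⟨D, hD0, hD⟩ := exists_energy_le_jacobiU_sq hα hβ
  obtain ⟨H, hH0, hH⟩ := exists_integral_jacobiU_sq_le hα hβ
  set C : ℝ := 2 ^ (α + β + 1) with hC
  have hC1 : 1 ≤ C := one_le_rpow (by norm_num) (by linarith)
  set K := |α ^ 2 - 1 / 4| + |β ^ 2 - 1 / 4| with hK
  -- The energy comparison factor exp(Kπ/(Na)) is independent of k, because the cut-off below
  -- satisfies Na = 1/(2C).
  set M := exp (K * π * (2 * C)) with hM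
  have hM0 : 0 < M := exp_pos _
  set G := √(M * D * (2 * H)) with hG
  have hG0 : 0 ≤ G := sqrt_nonneg _
  have hG2 : G ^ 2 = M * D * (2 * H) := sq_sqrt (by positivity)
  set T := α + β + 1 + |α - β| + 1 with hT
  have hT0 : 0 ≤ T := by linarith [abs_nonneg (α - β)]
  have hσ : 0 ≤ α + β + 1 := by linarith
  have hpi := pi_gt_three
  have q1 : 0 ≤ C * G := mul_nonneg (by linarith) hG0
  have q2 : 0 ≤ T * C * G := by rw [mul_assoc]; exact mul_nonneg hT0 q1
  have q3 : 0 ≤ (α + β + 1) * G := mul_nonneg hσ hG0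
  refine ⟨1 + 2 * C * G + T * C * G + (1 + (α + β + 1)) * G, by linarith, fun k x hx => ?_⟩
  have hk : (0 : ℝ) ≤ k := k.cast_nonneg
  have hN := jacobiFreq_ge (α := α) (β := β) (by linarith) (k + 1)
  push_cast at hN
  have hNle : jacobiFreq α β (k + 1) ≤ (1 + (α + β + 1)) * (k + 1) := by
    unfold jacobiFreq
    push_cast
    have := mul_nonneg hσ hk
    linarith
  set N := jacobiFreq α β (k + 1) with hNdef
  have hN1 : 1 ≤ N := by linarith
  set a := 1 / (2 * C * N) with ha
  have ha0 : 0 < a := by rw [ha]; positivity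
  have ha1 : a ≤ 1 / 2 := by
    rw [ha]
    have : 1 ≤ C * N := one_le_mul_of_one_le_of_one_le hC1 hN1
    exact one_div_le_one_div_of_le two_pos (by linarith)
  have hmid : ∀ x ∈ Icc a (π - a), |jacobiU α β (k + 1) x| ≤ G ∧
      |jacobiUDeriv α β (k + 1) x| ≤ G * N := by
    intro x hx
    set E := jacobiUDeriv α β (k + 1) x ^ 2 + N ^ 2 * jacobiU α β (k + 1) x ^ 2 with hE
    have hEt : ∀ t ∈ Icc (π / 4) (3 * π / 4), E ≤ M * (D * N ^ 2 *
        (jacobiU α β (k + 1) t ^ 2 + jacobiU α β (k + 2) t ^ 2)) := by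
      intro t ht
      have htI : t ∈ Ioo 0 π := ⟨by linarith [ht.1], by linarith [ht.2]⟩
      have h1 := energy_le (by linarith : 0 < N) ha0
        (fun x hx => hasDerivAt_jacobiU α β (k + 1) hx)
        (fun x hx => hasDerivAt_jacobiUDeriv (α := α) (β := β) (by linarith) k hx)
        (fun x hx => abs_jacobiPot_le α β hx) hx (t := t)
        ⟨by linarith [ht.1], by linarith [ht.2]⟩
      have e : K * π / (N * a) = K * π * (2 * C) := by rw [ha]; field_simp
      rw [← hK, e] at h1
      refine h1.trans ?_
      refine mul_le_mul_of_nonneg_left ?_ hM0.le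
      refine hD k t htI ?_
      have h2 := le_sin_of_mem_Icc (a := π / 4) (x := t) (by linarith)
        ⟨ht.1, by linarith [ht.2]⟩
      have e2 : 2 / π * (π / 4) = 1 / 2 := by field_simp; norm_num
      linarith
    have hc := continuous_jacobiU hα hβ
    have hcs : Continuous fun t => jacobiU α β (k + 1) t ^ 2 + jacobiU α β (k + 2) t ^ 2 :=
      ((hc _).pow 2).add ((hc _).pow 2)
    have hint : π / 2 * E ≤ M * (D * N ^ 2 * (2 * H)) := by
      have h1 : ∫ _ in (π / 4)..(3 * π / 4), E ≤ ∫ t in (π / 4)..(3 * π / 4), M * (D * N ^ 2 *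
          (jacobiU α β (k + 1) t ^ 2 + jacobiU α β (k + 2) t ^ 2)) :=
        integral_mono_on (by linarith) intervalIntegrable_const
          (((hcs.const_mul _).const_mul _).intervalIntegrable _ _) hEt
      rw [intervalIntegral.integral_const, smul_eq_mul, intervalIntegral.integral_const_mul,
        intervalIntegral.integral_const_mul] at h1
      have h2 : ∫ t in (π / 4)..(3 * π / 4), (jacobiU α β (k + 1) t ^ 2 +
          jacobiU α β (k + 2) t ^ 2) ≤ ∫ t in (0 : ℝ)..π, (jacobiU α β (k + 1) t ^ 2 +
          jacobiU α β (k + 2) t ^ 2) := by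
        refine integral_mono_interval (by linarith) (by linarith) (by linarith) ?_
          (hcs.intervalIntegrable _ _)
        exact Filter.Eventually.of_forall fun t => by simp only [Pi.zero_apply]; positivity
      have hI : ∀ n, IntervalIntegrable (fun t => jacobiU α β n t ^ 2) MeasureTheory.volume 0 π :=
        fun n => ((hc n).pow 2).intervalIntegrable _ _
      rw [integral_add (hI _) (hI _)] at h2
      have h3 := hH k
      have h4 := hH (k + 1)
      have e : k + 1 + 1 = k + 2 := rfl
      rw [e] at h4
      calc π / 2 * E = (3 * π / 4 - π / 4) * E := by ring
        _ ≤ _ := h1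
        _ ≤ _ := by gcongr; linarith
    have hE0 : 0 ≤ E := by rw [hE]; positivity
    have hEG : E ≤ (G * N) ^ 2 := by
      rw [mul_pow, hG2]
      have : E ≤ π / 2 * E := le_mul_of_one_le_left hE0 (by linarith)
      linarith
    constructor
    · refine abs_le_of_sq_le_sq ?_ hG0
      have h5 : N ^ 2 * jacobiU α β (k + 1) x ^ 2 ≤ N ^ 2 * G ^ 2 := by
        have := sq_nonneg (jacobiUDeriv α β (k + 1) x)
        rw [← mul_pow N G, mul_comm N G]
        linarith
      exact le_of_mul_le_mul_left h5 (by positivity)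
    · refine abs_le_of_sq_le_sq ?_ (by positivity)
      have : 0 ≤ N ^ 2 * jacobiU α β (k + 1) x ^ 2 := by positivity
      linarith
  have hsin := sin_pos_of_pos_of_lt_pi hx.1 hx.2
  have hinv : 0 < 1 / sin x := by positivity
  by_cases hxa : x ∈ Icc a (π - a)
  · obtain ⟨h1, h2⟩ := hmid x hxa
    refine ⟨by linarith, h2.trans ?_⟩
    calc G * N ≤ G * ((1 + (α + β + 1)) * (k + 1)) := by gcongr
      _ = (1 + (α + β + 1)) * G * (k + 1) := by ring
      _ ≤ _ := by
          refine mul_le_mul (by linarith) (by linarith) (by linarith) (by linarith)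
  · obtain ⟨h1, h2⟩ := abs_jacobiU_ends_le hα hβ k ha (fun y hy => (hmid y hy).1) hx hxa
    refine ⟨h1.trans (by linarith), ?_⟩
    rw [abs_mul, abs_of_pos hsin] at h2
    have h3 : |jacobiUDeriv α β (k + 1) x| ≤ T * C * G * (1 / sin x) := by
      rw [mul_one_div, le_div_iff₀ hsin]
      linarith
    refine h3.trans (mul_le_mul (by linarith) (by linarith) hinv.le (by linarith))

/-! ### Integration on the middle interval. -/

/-- The middle interval `[1/R, π - 1/R]`. -/
def midInterval (R : ℝ) : Set ℝ := Icc (1 / R) (π - 1 / R)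

theorem midInterval_facts {R : ℝ} (hR : 1 ≤ R) :
    0 < 1 / R ∧ 1 / R ≤ 1 ∧ 1 / R ≤ π - 1 / R := by
  have hpi := pi_gt_three
  have h1 : 0 < 1 / R := by positivity
  have h2 : 1 / R ≤ 1 := by rw [div_le_one (by linarith)]; exact hR
  exact ⟨h1, h2, by linarith⟩

theorem midInterval_subset {R : ℝ} (hR : 1 ≤ R) {x : ℝ} (hx : x ∈ midInterval R) :
    x ∈ Ioo 0 π := by
  obtain ⟨h1, _, _⟩ := midInterval_facts hR
  exact ⟨h1.trans_le hx.1, by linarith [hx.2]⟩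

theorem sin_pos_of_mem {R : ℝ} (hR : 1 ≤ R) {x : ℝ} (hx : x ∈ midInterval R) : 0 < sin x :=
  sin_pos_of_pos_of_lt_pi (midInterval_subset hR hx).1 (midInterval_subset hR hx).2

theorem inv_sin_le {R : ℝ} (hR : 1 ≤ R) {x : ℝ} (hx : x ∈ midInterval R) :
    1 / sin x ≤ 2 * R := by
  obtain ⟨h1, _, _⟩ := midInterval_facts hR
  have h := le_sin_of_mem_Icc h1.le hx
  have h4 := pi_lt_four
  have hpi := pi_pos
  rw [div_le_iff₀ (sin_pos_of_mem hR hx)]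
  have : 2 * R * (2 / π * (1 / R)) = 4 / π := by field_simp; norm_num
  have h5 : 1 ≤ 4 / π := by rw [le_div_iff₀ hpi]; linarith
  calc (1 : ℝ) ≤ 2 * R * (2 / π * (1 / R)) := by rw [this]; exact h5
    _ ≤ _ := by gcongr

theorem abs_integral_midInterval_le_const {R A : ℝ} (hR : 1 ≤ R) {f : ℝ → ℝ}
    (hb : ∀ x ∈ midInterval R, |f x| ≤ A) :
    |∫ x in (1 / R)..(π - 1 / R), f x| ≤ 4 * A := by
  obtain ⟨h1, h2, h3⟩ := midInterval_facts hR
  have hA : 0 ≤ A := (abs_nonneg _).trans (hb (1 / R) ⟨le_rfl, h3⟩)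
  have h := norm_integral_le_of_norm_le_const (a := 1 / R) (b := π - 1 / R) (f := f) (C := A)
    (fun x hx => hb x (by rw [uIoc_of_le h3] at hx; exact ⟨hx.1.le, hx.2⟩))
  rw [norm_eq_abs] at h
  refine h.trans ?_
  rw [abs_of_nonneg (by linarith), mul_comm]
  exact mul_le_mul_of_nonneg_right (by linarith [pi_lt_four]) hA

/-- A double pole at the ends costs only one factor R, since 1/sin² integrates to 2 cot(1/R) ≤ πR.
-/
theorem abs_integral_midInterval_le {R A : ℝ} (hR : 1 ≤ R) {f : ℝ → ℝ}
    (hb : ∀ x ∈ midInterval R, |f x| ≤ A / sin x ^ 2) :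
    |∫ x in (1 / R)..(π - 1 / R), f x| ≤ 4 * R * A := by
  obtain ⟨h1, h2, h3⟩ := midInterval_facts hR
  have hs : ∀ x ∈ midInterval R, sin x ≠ 0 := fun x hx => (sin_pos_of_mem hR hx).ne'
  have hA : 0 ≤ A := by
    have h0 : 1 / R ∈ midInterval R := ⟨le_rfl, h3⟩
    have := (abs_nonneg _).trans (hb _ h0)
    by_contra hneg
    have := div_neg_of_neg_of_pos (not_le.mp hneg) (pow_pos (sin_pos_of_mem hR h0) 2)
    linarith
  have hcont : ContinuousOn (fun x => A / sin x ^ 2) (uIcc (1 / R) (π - 1 / R)) := by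
    rw [uIcc_of_le h3]
    exact continuousOn_const.div (continuous_sin.pow 2).continuousOn
      fun x hx => pow_ne_zero 2 (hs x hx)
  have hii : IntervalIntegrable (fun x => A / sin x ^ 2) MeasureTheory.volume (1 / R)
    (π - 1 / R) := hcont.intervalIntegrable
  have h := norm_integral_le_of_norm_le h3 (f := f) (g := fun x => A / sin x ^ 2)
    (MeasureTheory.ae_of_all _ fun x hx => hb x ⟨hx.1.le, hx.2⟩) hii
  rw [norm_eq_abs] at h
  refine h.trans ?_
  have hi := integral_eq_sub_of_hasDerivAt (a := 1 / R) (b := π - 1 / R)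
    (f := fun x => -A * (cos x / sin x)) (f' := fun x => A / sin x ^ 2) (fun x hx => by
      rw [uIcc_of_le h3] at hx
      refine ((hasDerivAt_cot (hs x hx)).const_mul (-A)).congr_deriv ?_
      ring) hii
  rw [hi, cos_pi_sub, sin_pi_sub]
  have hc := (abs_le.mp (abs_cot_le h1 (x := 1 / R) ⟨le_rfl, h3⟩)).2
  have e : π / (2 * (1 / R)) = π / 2 * R := by field_simp
  rw [e] at hc
  have h5 : π / 2 * R ≤ 2 * R := by
    have := pi_lt_four
    gcongr
    linarith
  have h6 := mul_le_mul_of_nonneg_left (hc.trans h5) hA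
  calc _ = 2 * (A * (cos (1 / R) / sin (1 / R))) := by ring
    _ ≤ _ := by linarith

/-- Integration by parts as an estimate, with up to three remainder terms. -/
theorem abs_mul_integral_le {R c A₀ A₁ A₂ A₃ : ℝ} (hR : 1 ≤ R) {f F F' r₁ r₂ r₃ : ℝ → ℝ}
    (hF : ∀ x ∈ midInterval R, HasDerivAt F (F' x) x)
    (hf : ContinuousOn f (midInterval R)) (h₁ : ContinuousOn r₁ (midInterval R))
    (h₂ : ContinuousOn r₂ (midInterval R)) (h₃ : ContinuousOn r₃ (midInterval R))
    (heq : ∀ x ∈ midInterval R, c * f x = F' x + r₁ x + r₂ x + r₃ x)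
    (b₀ : |F (1 / R)| ≤ A₀) (b₀' : |F (π - 1 / R)| ≤ A₀)
    (b₁ : |∫ x in (1 / R)..(π - 1 / R), r₁ x| ≤ A₁)
    (b₂ : |∫ x in (1 / R)..(π - 1 / R), r₂ x| ≤ A₂)
    (b₃ : |∫ x in (1 / R)..(π - 1 / R), r₃ x| ≤ A₃) :
    |c| * |∫ x in (1 / R)..(π - 1 / R), f x| ≤ 2 * A₀ + A₁ + A₂ + A₃ := by
  obtain ⟨_, _, h3⟩ := midInterval_facts hR
  have hII : ∀ {g : ℝ → ℝ}, ContinuousOn g (midInterval R) →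
      IntervalIntegrable g MeasureTheory.volume (1 / R) (π - 1 / R) := fun {g} hg => by
    refine ContinuousOn.intervalIntegrable ?_
    rw [uIcc_of_le h3]
    exact hg
  -- Continuity of F' is read off from `heq`, so it need not be assumed.
  have hF'c : ContinuousOn F' (midInterval R) := by
    refine ((((hf.const_smul c).sub h₁).sub h₂).sub h₃).congr fun x hx => ?_
    simp only [Pi.sub_apply, Pi.smul_apply, smul_eq_mul]
    linarith [heq x hx]
  have hftc : ∫ x in (1 / R)..(π - 1 / R), F' x = F (π - 1 / R) - F (1 / R) := by
    refine integral_eq_sub_of_hasDerivAt (fun x hx => ?_) (hII hF'c)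
    rw [uIcc_of_le h3] at hx
    exact hF x hx
  have hmain : c * ∫ x in (1 / R)..(π - 1 / R), f x =
      (F (π - 1 / R) - F (1 / R)) + (∫ x in (1 / R)..(π - 1 / R), r₁ x) +
        (∫ x in (1 / R)..(π - 1 / R), r₂ x) + ∫ x in (1 / R)..(π - 1 / R), r₃ x := by
    rw [← hftc, ← integral_add (hII hF'c) (hII h₁),
      ← integral_add ((hII hF'c).add (hII h₁)) (hII h₂),
      ← integral_add (((hII hF'c).add (hII h₁)).add (hII h₂)) (hII h₃),
      ← intervalIntegral.integral_const_mul]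
    refine integral_congr fun x hx => ?_
    rw [uIcc_of_le h3] at hx
    exact heq x hx
  rw [← abs_mul, hmain]
  have t0 := abs_sub (F (π - 1 / R)) (F (1 / R))
  have t1 := abs_add_le (F (π - 1 / R) - F (1 / R)) (∫ x in (1 / R)..(π - 1 / R), r₁ x)
  have t2 := abs_add_le (F (π - 1 / R) - F (1 / R) + ∫ x in (1 / R)..(π - 1 / R), r₁ x)
    (∫ x in (1 / R)..(π - 1 / R), r₂ x)
  have t3 := abs_add_le (F (π - 1 / R) - F (1 / R) + (∫ x in (1 / R)..(π - 1 / R), r₁ x) +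
    ∫ x in (1 / R)..(π - 1 / R), r₂ x) (∫ x in (1 / R)..(π - 1 / R), r₃ x)
  linarith

/-! ### Oscillatory integrals of products of two solutions. -/

/-- A solution `u` of `u'' = (V - N²) u` on `(0, π)` that oscillates at frequency of order `R`,
with uniform bounds in terms of `P`. -/
structure IsOscillating (R P N : ℝ) (u u' V G : ℝ → ℝ) : Prop where
  deriv_u : ∀ x ∈ Ioo 0 π, HasDerivAt u (u' x) x
  deriv_u' : ∀ x ∈ Ioo 0 π, HasDerivAt u' ((V x - N ^ 2) * u x) x
  deriv_V : ∀ x ∈ Ioo 0 π, HasDerivAt (fun x => sin x * V x) (G x) x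
  cont_G : ContinuousOn G (Ioo 0 π)
  bound_V : ∀ x ∈ Ioo 0 π, |V x| ≤ P / sin x ^ 2
  bound_G : ∀ x ∈ Ioo 0 π, |G x| ≤ P / sin x ^ 2
  bound_u : ∀ x ∈ Ioo 0 π, |u x| ≤ P
  bound_u' : ∀ x ∈ Ioo 0 π, 3 * |u' x| ≤ P * (R + 1 / sin x)
  freq_nonneg : 0 ≤ N
  freq_le : N ≤ P * R

namespace IsOscillating

variable {R P N M : ℝ} {u u' V G v v' W H : ℝ → ℝ}

/-- The factor 3 in `bound_u'` absorbs R + 1/sin x ≤ 3R on the middle interval. -/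
theorem bound_u'_mid (hu : IsOscillating R P N u u' V G) (hR : 1 ≤ R) (hP : 1 ≤ P) {x : ℝ}
    (hx : x ∈ midInterval R) : |u' x| ≤ P * R := by
  have h1 := hu.bound_u' x (midInterval_subset hR hx)
  have h2 := inv_sin_le hR hx
  have : P * (R + 1 / sin x) ≤ P * (R + 2 * R) := by gcongr
  linarith

theorem cont_u (hu : IsOscillating R P N u u' V G) (hR : 1 ≤ R) :
    ContinuousOn u (midInterval R) := fun x hx =>
  (hu.deriv_u x (midInterval_subset hR hx)).continuousAt.continuousWithinAt

theorem cont_u' (hu : IsOscillating R P N u u' V G) (hR : 1 ≤ R) :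
    ContinuousOn u' (midInterval R) := fun x hx =>
  (hu.deriv_u' x (midInterval_subset hR hx)).continuousAt.continuousWithinAt

theorem cont_sinV (hu : IsOscillating R P N u u' V G) (hR : 1 ≤ R) :
    ContinuousOn (fun x => sin x * V x) (midInterval R) := fun x hx =>
  (hu.deriv_V x (midInterval_subset hR hx)).continuousAt.continuousWithinAt

theorem cont_V (hu : IsOscillating R P N u u' V G) (hR : 1 ≤ R) :
    ContinuousOn V (midInterval R) := by
  refine ((hu.cont_sinV hR).div continuous_sin.continuousOn
    fun x hx => (sin_pos_of_mem hR hx).ne').congr fun x hx => ?_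
  have := (sin_pos_of_mem hR hx).ne'
  simp only [Pi.div_apply]
  field_simp

theorem cont_G' (hu : IsOscillating R P N u u' V G) (hR : 1 ≤ R) :
    ContinuousOn G (midInterval R) := hu.cont_G.mono fun _ hx => midInterval_subset hR hx

theorem abs_sinV_le (hu : IsOscillating R P N u u' V G) (hR : 1 ≤ R) {x : ℝ}
    (hx : x ∈ midInterval R) : |sin x * V x| ≤ P / sin x := by
  have hs := sin_pos_of_mem hR hx
  rw [abs_mul, abs_of_pos hs]
  calc sin x * |V x| ≤ sin x * (P / sin x ^ 2) := by
        gcongr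
        exact hu.bound_V x (midInterval_subset hR hx)
    _ = _ := by field_simp


theorem abs_mul_le (hu : IsOscillating R P N u u' V G) (hv : IsOscillating R P M v v' W H)
    (hR : 1 ≤ R) (hP : 1 ≤ P) {x : ℝ} (hx : x ∈ midInterval R) :
    |u x * v x| ≤ P ^ 2 ∧ |u x * v' x| ≤ P ^ 2 * R ∧ |u' x * v x| ≤ P ^ 2 * R ∧
    |u' x * v' x| ≤ P ^ 2 * R ^ 2 := by
  have hI := midInterval_subset hR hx
  have a1 := hu.bound_u x hI
  have a2 := hv.bound_u x hI
  have a3 := hu.bound_u'_mid hR hP hx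
  have a4 := hv.bound_u'_mid hR hP hx
  have hP0 : 0 ≤ P := by linarith
  have hPR : 0 ≤ P * R := by positivity
  simp only [abs_mul]
  refine ⟨?_, ?_, ?_, ?_⟩
  · exact (mul_le_mul a1 a2 (abs_nonneg _) hP0).trans_eq (by ring)
  · exact (mul_le_mul a1 a4 (abs_nonneg _) hP0).trans_eq (by ring)
  · exact (mul_le_mul a3 a2 (abs_nonneg _) hPR).trans_eq (by ring)
  · exact (mul_le_mul a3 a4 (abs_nonneg _) hPR).trans_eq (by ring)

theorem abs_wronskian_le (hu : IsOscillating R P N u u' V G) (hv : IsOscillating R P M v v' W H)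
    (hR : 1 ≤ R) (hP : 1 ≤ P) {x : ℝ} (hx : x ∈ midInterval R) :
    |u x * v' x - u' x * v x| ≤ 2 * P ^ 2 * R ∧ |u x * v' x + u' x * v x| ≤ 2 * P ^ 2 * R := by
  obtain ⟨_, h1, h2, _⟩ := hu.abs_mul_le hv hR hP hx
  exact ⟨(abs_sub _ _).trans (by linarith), (abs_add_le _ _).trans (by linarith)⟩

theorem kappa_le (hu : IsOscillating R P N u u' V G) (hv : IsOscillating R P M v v' W H) :
    (N ^ 2 + M ^ 2) / 2 ≤ P ^ 2 * R ^ 2 := by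
  have h1 := pow_le_pow_left₀ hu.freq_nonneg hu.freq_le 2
  have h2 := pow_le_pow_left₀ hv.freq_nonneg hv.freq_le 2
  rw [mul_pow] at h1 h2
  linarith

theorem abs_energy_le (hu : IsOscillating R P N u u' V G) (hv : IsOscillating R P M v v' W H)
    (hR : 1 ≤ R) (hP : 1 ≤ P) {x : ℝ} (hx : x ∈ midInterval R) :
    |u' x * v' x + (N ^ 2 + M ^ 2) / 2 * (u x * v x)| ≤ 2 * P ^ 4 * R ^ 2 := by
  obtain ⟨h1, _, _, h2⟩ := hu.abs_mul_le hv hR hP hx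
  have h3 := hu.kappa_le hv
  have h4 : |(N ^ 2 + M ^ 2) / 2 * (u x * v x)| ≤ P ^ 2 * R ^ 2 * P ^ 2 := by
    rw [abs_mul, abs_of_nonneg (by positivity : 0 ≤ (N ^ 2 + M ^ 2) / 2)]
    gcongr
  have h5 : P ^ 2 * R ^ 2 ≤ P ^ 4 * R ^ 2 := by
    gcongr
    norm_num
  refine (abs_add_le _ _).trans ?_
  linarith

theorem deriv_wronskian (hu : IsOscillating R P N u u' V G) (hv : IsOscillating R P M v v' W H)
    {x : ℝ} (hx : x ∈ Ioo 0 π) : HasDerivAt (fun x => u x * v' x - u' x * v x)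
      ((N ^ 2 - M ^ 2 + W x - V x) * (u x * v x)) x := by
  refine (((hu.deriv_u x hx).mul (hv.deriv_u' x hx)).sub
    ((hu.deriv_u' x hx).mul (hv.deriv_u x hx))).congr_deriv ?_
  ring

theorem deriv_mul (hu : IsOscillating R P N u u' V G) (hv : IsOscillating R P M v v' W H)
    {x : ℝ} (hx : x ∈ Ioo 0 π) :
    HasDerivAt (fun x => u x * v x) (u x * v' x + u' x * v x) x := by
  refine ((hu.deriv_u x hx).mul (hv.deriv_u x hx)).congr_deriv ?_
  ring

theorem deriv_sum (hu : IsOscillating R P N u u' V G) (hv : IsOscillating R P M v v' W H)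
    {x : ℝ} (hx : x ∈ Ioo 0 π) : HasDerivAt (fun x => u x * v' x + u' x * v x)
      (2 * (u' x * v' x) + (V x + W x - (N ^ 2 + M ^ 2)) * (u x * v x)) x := by
  refine (((hu.deriv_u x hx).mul (hv.deriv_u' x hx)).add
    ((hu.deriv_u' x hx).mul (hv.deriv_u x hx))).congr_deriv ?_
  ring

/-- With the mean of N² and M² as coefficient, the frequency terms of uv' and u'v are opposite, so
they combine into the Wronskian. -/
theorem deriv_energy (hu : IsOscillating R P N u u' V G) (hv : IsOscillating R P M v v' W H)
    {x : ℝ} (hx : x ∈ Ioo 0 π) :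
    HasDerivAt (fun x => u' x * v' x + (N ^ 2 + M ^ 2) / 2 * (u x * v x))
      (-((N ^ 2 - M ^ 2) / 2) * (u x * v' x - u' x * v x) +
        V x * (u x * v' x) + W x * (u' x * v x)) x := by
  refine (((hu.deriv_u' x hx).mul (hv.deriv_u' x hx)).add
    ((hu.deriv_mul hv hx).const_mul _)).congr_deriv ?_
  ring

/-- Integration by parts of cos times the Wronskian, whose derivative is (N² - M²)uv plus a
potential term. The Wronskian is O(R), and the potential term also integrates to O(R). -/
theorem abs_integral_cos_mul (hu : IsOscillating R P N u u' V G)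
    (hv : IsOscillating R P M v v' W H) (hR : 1 ≤ R) (hP : 1 ≤ P) :
    |N ^ 2 - M ^ 2| * |∫ x in (1 / R)..(π - 1 / R), cos x * (u x * v x)| ≤ 20 * P ^ 3 * R := by
  obtain ⟨_, _, h3⟩ := midInterval_facts hR
  have cu := hu.cont_u hR
  have cu' := hu.cont_u' hR
  have cv := hv.cont_u hR
  have cv' := hv.cont_u' hR
  have cV := hu.cont_V hR
  have cW := hv.cont_V hR
  have bF : ∀ x ∈ midInterval R, |cos x * (u x * v' x - u' x * v x)| ≤ 2 * P ^ 2 * R := by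
    intro x hx
    rw [abs_mul]
    exact (mul_le_of_le_one_left (abs_nonneg _) (abs_cos_le_one x)).trans
      (hu.abs_wronskian_le hv hR hP hx).1
  have h := abs_mul_integral_le (c := N ^ 2 - M ^ 2) (f := fun x => cos x * (u x * v x)) hR
    (F := fun x => cos x * (u x * v' x - u' x * v x))
    (F' := fun x => -sin x * (u x * v' x - u' x * v x) +
      cos x * ((N ^ 2 - M ^ 2 + W x - V x) * (u x * v x)))
    (r₁ := fun x => sin x * (u x * v' x - u' x * v x))
    (r₂ := fun x => -(cos x * ((W x - V x) * (u x * v x)))) (r₃ := fun _ => 0)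
    (A₀ := 2 * P ^ 2 * R) (A₁ := 4 * (2 * P ^ 2 * R)) (A₂ := 4 * R * (2 * P ^ 3)) (A₃ := 0)
    (fun x hx => (hasDerivAt_cos x).mul (hu.deriv_wronskian hv (midInterval_subset hR hx)))
    (by fun_prop) (by fun_prop) (by fun_prop) (by fun_prop)
    (fun x _ => by ring) (bF _ ⟨le_rfl, h3⟩) (bF _ ⟨h3, le_rfl⟩)
    (abs_integral_midInterval_le_const hR fun x hx => by
      rw [abs_mul]
      exact (mul_le_of_le_one_left (abs_nonneg _) (abs_sin_le_one x)).trans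
        (hu.abs_wronskian_le hv hR hP hx).1)
    (abs_integral_midInterval_le hR fun x hx => by
      have hI := midInterval_subset hR hx
      have b1 := hu.bound_V x hI
      have b2 := hv.bound_V x hI
      have b3 := (hu.abs_mul_le hv hR hP hx).1
      have hs := sin_pos_of_mem hR hx
      rw [abs_neg, abs_mul, abs_mul]
      refine (mul_le_of_le_one_left (by positivity) (abs_cos_le_one x)).trans ?_
      calc |W x - V x| * |u x * v x| ≤ (P / sin x ^ 2 + P / sin x ^ 2) * P ^ 2 := by
            gcongr
            exact (abs_sub _ _).trans (add_le_add b2 b1)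
        _ = _ := by ring)
    (by simp)
  have h4 : P ^ 2 * R ≤ P ^ 3 * R := by
    gcongr
    norm_num
  linarith

/-- Oscillatory bound for a singular weight `g = O(1 / sin)`. -/
theorem abs_integral_singular (hu : IsOscillating R P N u u' V G)
    (hv : IsOscillating R P M v v' W H) (hR : 1 ≤ R) (hP : 1 ≤ P) {g g' : ℝ → ℝ}
    (hg : ∀ x ∈ midInterval R, HasDerivAt g (g' x) x) (hg' : ContinuousOn g' (midInterval R))
    (bg : ∀ x ∈ midInterval R, |g x| ≤ P / sin x)
    (bg' : ∀ x ∈ midInterval R, |g' x| ≤ P / sin x ^ 2) (hΔ : N ^ 2 - M ^ 2 ≠ 0) :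
    |∫ x in (1 / R)..(π - 1 / R), g x * (u x * v' x)| ≤
      4 * P ^ 3 * R + 32 * P ^ 5 * R ^ 3 / |N ^ 2 - M ^ 2| ∧
    |∫ x in (1 / R)..(π - 1 / R), g x * (u' x * v x)| ≤
      4 * P ^ 3 * R + 32 * P ^ 5 * R ^ 3 / |N ^ 2 - M ^ 2| := by
  obtain ⟨_, _, h3⟩ := midInterval_facts hR
  have cu := hu.cont_u hR
  have cu' := hu.cont_u' hR
  have cv := hv.cont_u hR
  have cv' := hv.cont_u' hR
  have cV := hu.cont_V hR
  have cW := hv.cont_V hR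
  have cg : ContinuousOn g (midInterval R) :=
    fun x hx => (hg x hx).continuousAt.continuousWithinAt
  have hP0 : 0 < P := by linarith
  have hR0 : 0 < R := by linarith
  have hΔ0 : 0 < |N ^ 2 - M ^ 2| := abs_pos.mpr hΔ
  have bgR : ∀ x ∈ midInterval R, |g x| ≤ 2 * P * R := by
    intro x hx
    refine (bg x hx).trans ?_
    have := inv_sin_le hR hx
    calc P / sin x = P * (1 / sin x) := by ring
      _ ≤ P * (2 * R) := by gcongr
      _ = _ := by ring
  set κ := (N ^ 2 + M ^ 2) / 2 with hκ
  have bF : ∀ x ∈ midInterval R, |-(g x * (u' x * v' x + κ * (u x * v x)))| ≤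
      4 * P ^ 5 * R ^ 3 := by
    intro x hx
    rw [abs_neg, abs_mul]
    calc _ ≤ 2 * P * R * (2 * P ^ 4 * R ^ 2) := by
          gcongr
          exacts [bgR x hx, hu.abs_energy_le hv hR hP hx]
      _ = _ := by ring
  -- The Wronskian part of the integrand is reached through the derivative of the mixed energy and
  -- gains the factor N² - M²; the symmetric part, `hS`, is g·(uv)' and is integrated by parts
  -- directly.
  have hY := abs_mul_integral_le (c := (N ^ 2 - M ^ 2) / 2)
    (f := fun x => g x * (u x * v' x - u' x * v x)) hR
    (F := fun x => -(g x * (u' x * v' x + κ * (u x * v x))))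
    (F' := fun x => -(g' x * (u' x * v' x + κ * (u x * v x)) +
      g x * (-((N ^ 2 - M ^ 2) / 2) * (u x * v' x - u' x * v x) +
        V x * (u x * v' x) + W x * (u' x * v x))))
    (r₁ := fun x => g' x * (u' x * v' x + κ * (u x * v x)))
    (r₂ := fun x => g x * (V x * (u x * v' x))) (r₃ := fun x => g x * (W x * (u' x * v x)))
    (A₀ := 4 * P ^ 5 * R ^ 3) (A₁ := 4 * R * (2 * P ^ 5 * R ^ 2))
    (A₂ := 4 * R * (2 * P ^ 4 * R ^ 2)) (A₃ := 4 * R * (2 * P ^ 4 * R ^ 2))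
    (fun x hx => ((hg x hx).mul (hu.deriv_energy hv (midInterval_subset hR hx))).neg)
    (by fun_prop) (by fun_prop) (by fun_prop) (by fun_prop)
    (fun x _ => by ring) (bF _ ⟨le_rfl, h3⟩) (bF _ ⟨h3, le_rfl⟩)
    (abs_integral_midInterval_le hR fun x hx => by
      rw [abs_mul]
      calc _ ≤ P / sin x ^ 2 * (2 * P ^ 4 * R ^ 2) := by
            gcongr
            exacts [bg' x hx, hu.abs_energy_le hv hR hP hx]
        _ = _ := by ring)
    (abs_integral_midInterval_le hR fun x hx => by
      rw [abs_mul, abs_mul]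
      calc _ ≤ 2 * P * R * (P / sin x ^ 2 * (P ^ 2 * R)) := by
            gcongr
            exacts [bgR x hx, hu.bound_V x (midInterval_subset hR hx),
              (hu.abs_mul_le hv hR hP hx).2.1]
        _ = _ := by ring)
    (abs_integral_midInterval_le hR fun x hx => by
      rw [abs_mul, abs_mul]
      calc _ ≤ 2 * P * R * (P / sin x ^ 2 * (P ^ 2 * R)) := by
            gcongr
            exacts [bgR x hx, hv.bound_V x (midInterval_subset hR hx),
              (hu.abs_mul_le hv hR hP hx).2.2.1]
        _ = _ := by ring)
  have hY' : |∫ x in (1 / R)..(π - 1 / R), g x * (u x * v' x - u' x * v x)| ≤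
      64 * P ^ 5 * R ^ 3 / |N ^ 2 - M ^ 2| := by
    rw [le_div_iff₀ hΔ0]
    rw [abs_div, abs_two] at hY
    have : P ^ 4 * R ^ 3 ≤ P ^ 5 * R ^ 3 := by
      gcongr
      norm_num
    linarith
  have bA : ∀ x ∈ midInterval R, |g x * (u x * v x)| ≤ 2 * P ^ 3 * R := by
    intro x hx
    rw [abs_mul]
    calc _ ≤ 2 * P * R * P ^ 2 := by
          gcongr
          exacts [bgR x hx, (hu.abs_mul_le hv hR hP hx).1]
      _ = _ := by ring
  have hS := abs_mul_integral_le (c := 1)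
    (f := fun x => g x * (u x * v' x + u' x * v x)) hR
    (F := fun x => g x * (u x * v x))
    (F' := fun x => g' x * (u x * v x) + g x * (u x * v' x + u' x * v x))
    (r₁ := fun x => -(g' x * (u x * v x))) (r₂ := fun _ => 0) (r₃ := fun _ => 0)
    (A₀ := 2 * P ^ 3 * R) (A₁ := 4 * R * P ^ 3) (A₂ := 0) (A₃ := 0)
    (fun x hx => (hg x hx).mul (hu.deriv_mul hv (midInterval_subset hR hx)))
    (by fun_prop) (by fun_prop) (by fun_prop) (by fun_prop)
    (fun x _ => by ring) (bA _ ⟨le_rfl, h3⟩) (bA _ ⟨h3, le_rfl⟩)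
    (abs_integral_midInterval_le hR fun x hx => by
      rw [abs_neg, abs_mul]
      calc _ ≤ P / sin x ^ 2 * P ^ 2 := by
            gcongr
            exacts [bg' x hx, (hu.abs_mul_le hv hR hP hx).1]
        _ = _ := by ring)
    (by simp) (by simp)
  have hS' : |∫ x in (1 / R)..(π - 1 / R), g x * (u x * v' x + u' x * v x)| ≤ 8 * P ^ 3 * R := by
    rw [abs_one] at hS
    linarith
  have hsplit : 32 * P ^ 5 * R ^ 3 / |N ^ 2 - M ^ 2| =
      (64 * P ^ 5 * R ^ 3 / |N ^ 2 - M ^ 2|) / 2 := by ring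
  constructor
  -- With F = 0 the lemma is just the triangle inequality for 2uv' = (uv' + u'v) + (uv' - u'v).
  · have h := abs_mul_integral_le (c := 2) (f := fun x => g x * (u x * v' x)) hR
      (F := fun _ => 0) (F' := fun _ => 0)
      (r₁ := fun x => g x * (u x * v' x + u' x * v x))
      (r₂ := fun x => g x * (u x * v' x - u' x * v x)) (r₃ := fun _ => 0) (A₀ := 0) (A₃ := 0)
      (fun x _ => hasDerivAt_const x 0)
      (by fun_prop) (by fun_prop) (by fun_prop) (by fun_prop)
      (fun x _ => by ring) (by simp) (by simp) hS' hY' (by simp)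
    rw [abs_two] at h
    linarith
  · have h := abs_mul_integral_le (c := 2) (f := fun x => g x * (u' x * v x)) hR
      (F := fun _ => 0) (F' := fun _ => 0)
      (r₁ := fun x => g x * (u x * v' x + u' x * v x))
      (r₂ := fun x => -(g x * (u x * v' x - u' x * v x))) (r₃ := fun _ => 0) (A₀ := 0)
      (A₂ := 64 * P ^ 5 * R ^ 3 / |N ^ 2 - M ^ 2|) (A₃ := 0)
      (fun x _ => hasDerivAt_const x 0)
      (by fun_prop) (by fun_prop) (by fun_prop) (by fun_prop)
      (fun x _ => by ring) (by simp) (by simp) hS'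
      (by rw [intervalIntegral.integral_neg, abs_neg]; exact hY') (by simp)
    rw [abs_two] at h
    linarith

/-- Twice the energy is (uv)'' plus 2(N² + M²)uv minus (V + W)uv. The large multiple of uv is
harmless because its integral against cos already carries the factor 1/|N² - M²|. -/
theorem abs_integral_cos_energy (hu : IsOscillating R P N u u' V G)
    (hv : IsOscillating R P M v v' W H) (hR : 1 ≤ R) (hP : 1 ≤ P) (hΔ : N ^ 2 - M ^ 2 ≠ 0) :
    |∫ x in (1 / R)..(π - 1 / R),
      cos x * (u' x * v' x + (N ^ 2 + M ^ 2) / 2 * (u x * v x))| ≤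
      10 * P ^ 3 * R + 40 * P ^ 5 * R ^ 3 / |N ^ 2 - M ^ 2| := by
  obtain ⟨_, _, h3⟩ := midInterval_facts hR
  have cu := hu.cont_u hR
  have cu' := hu.cont_u' hR
  have cv := hv.cont_u hR
  have cv' := hv.cont_u' hR
  have cV := hu.cont_V hR
  have cW := hv.cont_V hR
  have hP0 : 0 < P := by linarith
  have hR0 : 0 < R := by linarith
  have hΔ0 : 0 < |N ^ 2 - M ^ 2| := abs_pos.mpr hΔ
  set κ := (N ^ 2 + M ^ 2) / 2 with hκ
  have hκ0 : 0 ≤ κ := by rw [hκ]; positivity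
  have hκle : κ ≤ P ^ 2 * R ^ 2 := hu.kappa_le hv
  have hX : |∫ x in (1 / R)..(π - 1 / R), cos x * (u x * v x)| ≤
      20 * P ^ 3 * R / |N ^ 2 - M ^ 2| := by
    rw [le_div_iff₀ hΔ0, mul_comm]
    exact hu.abs_integral_cos_mul hv hR hP
  have bF : ∀ x ∈ midInterval R, |cos x * (u x * v' x + u' x * v x)| ≤ 2 * P ^ 2 * R := by
    intro x hx
    rw [abs_mul]
    exact (mul_le_of_le_one_left (abs_nonneg _) (abs_cos_le_one x)).trans
      (hu.abs_wronskian_le hv hR hP hx).2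
  have h := abs_mul_integral_le (c := 2)
    (f := fun x => cos x * (u' x * v' x + κ * (u x * v x))) hR
    (F := fun x => cos x * (u x * v' x + u' x * v x))
    (F' := fun x => -sin x * (u x * v' x + u' x * v x) +
      cos x * (2 * (u' x * v' x) + (V x + W x - (N ^ 2 + M ^ 2)) * (u x * v x)))
    (r₁ := fun x => sin x * (u x * v' x + u' x * v x))
    (r₂ := fun x => 4 * κ * (cos x * (u x * v x)))
    (r₃ := fun x => -(cos x * ((V x + W x) * (u x * v x))))
    (A₀ := 2 * P ^ 2 * R) (A₁ := 4 * (2 * P ^ 2 * R))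
    (A₂ := 4 * (P ^ 2 * R ^ 2) * (20 * P ^ 3 * R / |N ^ 2 - M ^ 2|)) (A₃ := 4 * R * (2 * P ^ 3))
    (fun x hx => (hasDerivAt_cos x).mul (hu.deriv_sum hv (midInterval_subset hR hx)))
    (by fun_prop) (by fun_prop) (by fun_prop) (by fun_prop)
    (fun x _ => by rw [hκ]; ring) (bF _ ⟨le_rfl, h3⟩) (bF _ ⟨h3, le_rfl⟩)
    (abs_integral_midInterval_le_const hR fun x hx => by
      rw [abs_mul]
      exact (mul_le_of_le_one_left (abs_nonneg _) (abs_sin_le_one x)).trans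
        (hu.abs_wronskian_le hv hR hP hx).2)
    (by
      rw [intervalIntegral.integral_const_mul, abs_mul,
        abs_of_nonneg (by positivity : 0 ≤ 4 * κ)]
      gcongr)
    (abs_integral_midInterval_le hR fun x hx => by
      have hI := midInterval_subset hR hx
      have b1 := hu.bound_V x hI
      have b2 := hv.bound_V x hI
      have b3 := (hu.abs_mul_le hv hR hP hx).1
      have hs := sin_pos_of_mem hR hx
      rw [abs_neg, abs_mul, abs_mul]
      refine (mul_le_of_le_one_left (by positivity) (abs_cos_le_one x)).trans ?_
      calc |V x + W x| * |u x * v x| ≤ (P / sin x ^ 2 + P / sin x ^ 2) * P ^ 2 := by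
            gcongr
            exact (abs_add_le _ _).trans (add_le_add b1 b2)
        _ = _ := by ring)
  have h4 : P ^ 2 * R ≤ P ^ 3 * R := by
    gcongr
    norm_num
  have e : 4 * (P ^ 2 * R ^ 2) * (20 * P ^ 3 * R / |N ^ 2 - M ^ 2|) =
      2 * (40 * P ^ 5 * R ^ 3 / |N ^ 2 - M ^ 2|) := by ring
  rw [abs_two, e] at h
  linarith

theorem abs_sin_endpoints {R : ℝ} (hR : 1 ≤ R) :
    |sin (1 / R)| ≤ 1 / R ∧ |sin (π - 1 / R)| ≤ 1 / R := by
  obtain ⟨h1, _, _⟩ := midInterval_facts hR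
  rw [sin_pi_sub]
  have := abs_sin_le_abs (x := 1 / R)
  rw [abs_of_pos h1] at this
  exact ⟨this, this⟩

/-- The derivative of sin times the energy produces the Wronskian with factor N² - M². The weights
sin·V and sin·W are only O(1/sin), so those remainders require a second use of oscillation, in
`abs_integral_singular`. -/
theorem abs_integral_sin_wronskian (hu : IsOscillating R P N u u' V G)
    (hv : IsOscillating R P M v v' W H) (hR : 1 ≤ R) (hP : 1 ≤ P) (hΔ : N ^ 2 - M ^ 2 ≠ 0) :
    |N ^ 2 - M ^ 2| * |∫ x in (1 / R)..(π - 1 / R), sin x * (u x * v' x - u' x * v x)| ≤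
      44 * P ^ 4 * R + 208 * P ^ 5 * R ^ 3 / |N ^ 2 - M ^ 2| := by
  obtain ⟨_, _, h3⟩ := midInterval_facts hR
  have cu := hu.cont_u hR
  have cu' := hu.cont_u' hR
  have cv := hv.cont_u hR
  have cv' := hv.cont_u' hR
  have cV := hu.cont_V hR
  have cW := hv.cont_V hR
  have csV := hu.cont_sinV hR
  have csW := hv.cont_sinV hR
  have hP0 : 0 < P := by linarith
  have hR0 : 0 < R := by linarith
  have hZ := hu.abs_integral_cos_energy hv hR hP hΔ
  have h1 := (hu.abs_integral_singular hv hR hP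
    (fun x hx => hu.deriv_V x (midInterval_subset hR hx)) (hu.cont_G' hR)
    (fun x hx => hu.abs_sinV_le hR hx)
    (fun x hx => hu.bound_G x (midInterval_subset hR hx)) hΔ).1
  have h2 := (hu.abs_integral_singular hv hR hP
    (fun x hx => hv.deriv_V x (midInterval_subset hR hx)) (hv.cont_G' hR)
    (fun x hx => hv.abs_sinV_le hR hx)
    (fun x hx => hv.bound_G x (midInterval_subset hR hx)) hΔ).2
  set κ := (N ^ 2 + M ^ 2) / 2 with hκ
  have bF : ∀ x ∈ midInterval R, |sin x| ≤ 1 / R →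
      |-(sin x * (u' x * v' x + κ * (u x * v x)))| ≤ 2 * P ^ 4 * R := by
    intro x hx hs
    rw [abs_neg, abs_mul]
    calc _ ≤ 1 / R * (2 * P ^ 4 * R ^ 2) := by
          gcongr
          exact hu.abs_energy_le hv hR hP hx
      _ = _ := by field_simp
  have h := abs_mul_integral_le (c := (N ^ 2 - M ^ 2) / 2)
    (f := fun x => sin x * (u x * v' x - u' x * v x)) hR
    (F := fun x => -(sin x * (u' x * v' x + κ * (u x * v x))))
    (F' := fun x => -(cos x * (u' x * v' x + κ * (u x * v x)) +
      sin x * (-((N ^ 2 - M ^ 2) / 2) * (u x * v' x - u' x * v x) +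
        V x * (u x * v' x) + W x * (u' x * v x))))
    (r₁ := fun x => cos x * (u' x * v' x + κ * (u x * v x)))
    (r₂ := fun x => sin x * V x * (u x * v' x)) (r₃ := fun x => sin x * W x * (u' x * v x))
    (A₀ := 2 * P ^ 4 * R)
    (fun x hx => ((hasDerivAt_sin x).mul (hu.deriv_energy hv (midInterval_subset hR hx))).neg)
    (by fun_prop) (by fun_prop) (by fun_prop) (by fun_prop)
    (fun x _ => by ring) (bF _ ⟨le_rfl, h3⟩ (abs_sin_endpoints hR).1)
    (bF _ ⟨h3, le_rfl⟩ (abs_sin_endpoints hR).2) hZ h1 h2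
  have h4 : P ^ 3 * R ≤ P ^ 4 * R := by
    gcongr
    norm_num
  have e1 : 208 * P ^ 5 * R ^ 3 / |N ^ 2 - M ^ 2| =
    2 * (40 * P ^ 5 * R ^ 3 / |N ^ 2 - M ^ 2|) +
      4 * (32 * P ^ 5 * R ^ 3 / |N ^ 2 - M ^ 2|) := by ring
  rw [abs_div, abs_two] at h
  rw [e1]
  linarith

/-- Combines the two previous gains through 2 sin·u'v = (sin·uv)' - cos·uv - sin·(uv' - u'v). -/
theorem abs_integral_mid (hu : IsOscillating R P N u u' V G)
    (hv : IsOscillating R P M v v' W H) (hR : 1 ≤ R) (hP : 1 ≤ P) (hΔ : N ^ 2 - M ^ 2 ≠ 0) :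
    |∫ x in (1 / R)..(π - 1 / R), sin x * (u' x * v x)| ≤
      P ^ 2 / R + 32 * P ^ 4 * R / |N ^ 2 - M ^ 2| +
        104 * P ^ 5 * R ^ 3 / |N ^ 2 - M ^ 2| ^ 2 := by
  obtain ⟨_, _, h3⟩ := midInterval_facts hR
  have cu := hu.cont_u hR
  have cu' := hu.cont_u' hR
  have cv := hv.cont_u hR
  have cv' := hv.cont_u' hR
  have hP0 : 0 < P := by linarith
  have hR0 : 0 < R := by linarith
  have hΔ0 : 0 < |N ^ 2 - M ^ 2| := abs_pos.mpr hΔ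
  have hX : |∫ x in (1 / R)..(π - 1 / R), cos x * (u x * v x)| ≤
      20 * P ^ 3 * R / |N ^ 2 - M ^ 2| := by
    rw [le_div_iff₀ hΔ0, mul_comm]
    exact hu.abs_integral_cos_mul hv hR hP
  have hQ : |∫ x in (1 / R)..(π - 1 / R), sin x * (u x * v' x - u' x * v x)| ≤
      (44 * P ^ 4 * R + 208 * P ^ 5 * R ^ 3 / |N ^ 2 - M ^ 2|) / |N ^ 2 - M ^ 2| := by
    rw [le_div_iff₀ hΔ0, mul_comm]
    exact hu.abs_integral_sin_wronskian hv hR hP hΔ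
  have bF : ∀ x ∈ midInterval R, |sin x| ≤ 1 / R → |sin x * (u x * v x)| ≤ P ^ 2 / R := by
    intro x hx hs
    rw [abs_mul]
    calc _ ≤ 1 / R * P ^ 2 := by
          gcongr
          exact (hu.abs_mul_le hv hR hP hx).1
      _ = _ := by ring
  have h := abs_mul_integral_le (c := 2) (f := fun x => sin x * (u' x * v x)) hR
    (F := fun x => sin x * (u x * v x))
    (F' := fun x => cos x * (u x * v x) + sin x * (u x * v' x + u' x * v x))
    (r₁ := fun x => -(cos x * (u x * v x)))
    (r₂ := fun x => -(sin x * (u x * v' x - u' x * v x))) (r₃ := fun _ => 0)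
    (A₀ := P ^ 2 / R) (A₁ := 20 * P ^ 3 * R / |N ^ 2 - M ^ 2|)
    (A₂ := (44 * P ^ 4 * R + 208 * P ^ 5 * R ^ 3 / |N ^ 2 - M ^ 2|) / |N ^ 2 - M ^ 2|) (A₃ := 0)
    (fun x hx => (hasDerivAt_sin x).mul (hu.deriv_mul hv (midInterval_subset hR hx)))
    (by fun_prop) (by fun_prop) (by fun_prop) (by fun_prop)
    (fun x _ => by ring) (bF _ ⟨le_rfl, h3⟩ (abs_sin_endpoints hR).1)
    (bF _ ⟨h3, le_rfl⟩ (abs_sin_endpoints hR).2)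
    (by rw [intervalIntegral.integral_neg, abs_neg]; exact hX)
    (by rw [intervalIntegral.integral_neg, abs_neg]; exact hQ) (by simp)
  rw [abs_two] at h
  have h4 : 20 * P ^ 3 * R / |N ^ 2 - M ^ 2| ≤ 20 * P ^ 4 * R / |N ^ 2 - M ^ 2| := by
    gcongr
    norm_num
  have e : (44 * P ^ 4 * R + 208 * P ^ 5 * R ^ 3 / |N ^ 2 - M ^ 2|) / |N ^ 2 - M ^ 2| =
      44 / 20 * (20 * P ^ 4 * R / |N ^ 2 - M ^ 2|) +
        2 * (104 * P ^ 5 * R ^ 3 / |N ^ 2 - M ^ 2| ^ 2) := by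
    field_simp
    ring
  have e2 : 32 * P ^ 4 * R / |N ^ 2 - M ^ 2| =
    32 / 20 * (20 * P ^ 4 * R / |N ^ 2 - M ^ 2|) := by ring
  rw [e] at h
  rw [e2]
  linarith

end IsOscillating

/-! ### The Jacobi functions as oscillating solutions. -/

/-- The derivative of `sin x` times `jacobiPot`. -/
noncomputable def sinPotDeriv (α β x : ℝ) : ℝ :=
  -(α ^ 2 - 1 / 4) / (4 * sin (x / 2) ^ 2) + (β ^ 2 - 1 / 4) / (4 * cos (x / 2) ^ 2)

theorem hasDerivAt_sin_mul_jacobiPot (α β : ℝ) {x : ℝ} (hx : x ∈ Ioo 0 π) :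
    HasDerivAt (fun x => sin x * jacobiPot α β x) (sinPotDeriv α β x) x := by
  have h1 := sin_half_pos hx
  have h2 := cos_half_pos hx
  have e1 := ((hasDerivAt_cos_half x).div (hasDerivAt_sin_half x) h1.ne').const_mul
    ((α ^ 2 - 1 / 4) / 2)
  have e2 := ((hasDerivAt_sin_half x).div (hasDerivAt_cos_half x) h2.ne').const_mul
    ((β ^ 2 - 1 / 4) / 2)
  have he : (fun x => sin x * jacobiPot α β x) =ᶠ[𝓝 x]
      fun x => (α ^ 2 - 1 / 4) / 2 * (cos (x / 2) / sin (x / 2)) +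
        (β ^ 2 - 1 / 4) / 2 * (sin (x / 2) / cos (x / 2)) := by
    filter_upwards [isOpen_Ioo.mem_nhds hx] with y hy
    have h1 := sin_half_pos hy
    have h2 := cos_half_pos hy
    unfold jacobiPot
    rw [sin_eq_half y]
    field_simp
    ring
  refine ((e1.add e2).congr_of_eventuallyEq he).congr_deriv ?_
  have h3 := sin_sq_add_cos_sq (x / 2)
  have e3 : (-sin (x / 2) / 2 * sin (x / 2) - cos (x / 2) * (cos (x / 2) / 2)) = - 1 / 2 := by
    linarith
  have e4 : (cos (x / 2) / 2 * cos (x / 2) - sin (x / 2) * (-sin (x / 2) / 2)) = 1 / 2 := by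
    linarith
  rw [e3, e4]
  unfold sinPotDeriv
  field_simp
  ring

theorem continuousOn_sinPotDeriv (α β : ℝ) : ContinuousOn (sinPotDeriv α β) (Ioo 0 π) := by
  have hs : Continuous fun x : ℝ => 4 * sin (x / 2) ^ 2 := by fun_prop
  have hc : Continuous fun x : ℝ => 4 * cos (x / 2) ^ 2 := by fun_prop
  refine (continuousOn_const.div hs.continuousOn fun x hx => ?_).add
    (continuousOn_const.div hc.continuousOn fun x hx => ?_)
  · have := sin_half_pos hx
    positivity
  · have := cos_half_pos hx
    positivity

theorem abs_sinPotDeriv_le (α β : ℝ) {x : ℝ} (hx : x ∈ Ioo 0 π) :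
    |sinPotDeriv α β x| ≤ (|α ^ 2 - 1 / 4| + |β ^ 2 - 1 / 4|) / sin x ^ 2 := by
  have h1 := sin_half_pos hx
  have h2 := cos_half_pos hx
  have e : sinPotDeriv α β x = (-(α ^ 2 - 1 / 4) * cos (x / 2) ^ 2 +
      (β ^ 2 - 1 / 4) * sin (x / 2) ^ 2) / sin x ^ 2 := by
    unfold sinPotDeriv
    rw [sin_eq_half x]
    field_simp
    ring
  rw [e, abs_div, abs_of_nonneg (sq_nonneg (sin x))]
  gcongr
  refine (abs_add_le _ _).trans ?_
  rw [abs_mul, abs_mul, abs_neg, abs_of_nonneg (sq_nonneg (cos (x / 2))),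
    abs_of_nonneg (sq_nonneg (sin (x / 2)))]
  exact add_le_add (mul_le_of_le_one_right (abs_nonneg _) (cos_sq_le_one _))
    (mul_le_of_le_one_right (abs_nonneg _) (sin_sq_le_one _))

theorem exists_isOscillating {α β : ℝ} (hα : -1 / 2 ≤ α) (hβ : -1 / 2 ≤ β) :
    ∃ P₀ : ℝ, ∀ P, P₀ ≤ P → (∀ (k : ℕ), ∀ x ∈ Ioo 0 π, |jacobiU α β (k + 1) x| ≤ P) ∧
      ∀ (R : ℝ) (k : ℕ), 1 ≤ R → (k : ℝ) + 1 ≤ 2 * R →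
        IsOscillating R P (jacobiFreq α β (k + 1)) (jacobiU α β (k + 1))
          (jacobiUDeriv α β (k + 1)) (jacobiPot α β) (sinPotDeriv α β) := by
  obtain ⟨B, hB1, hB⟩ := exists_jacobiU_bound hα hβ
  set K := |α ^ 2 - 1 / 4| + |β ^ 2 - 1 / 4| with hK
  have hK0 : 0 ≤ K := by positivity
  have hσ : 0 ≤ α + β + 1 := by linarith
  -- The 6 is the 3 of `bound_u'` times the 2 from k + 1 ≤ 2R; K bounds the potential and its
  -- companion, and the last term bounds the frequency. Every larger P works too, so two families
  -- can share one constant.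
  refine ⟨6 * B + K + 2 * (1 + (α + β + 1)), fun P hP => ?_⟩
  have hPB : B ≤ P := by linarith
  have hPK : K ≤ P := by linarith
  refine ⟨fun k x hx => (hB k x hx).1.trans hPB, fun R k hR hk => ?_⟩
  have hk0 : (0 : ℝ) ≤ k := k.cast_nonneg
  refine ⟨fun x hx => hasDerivAt_jacobiU α β _ hx,
    fun x hx => hasDerivAt_jacobiUDeriv (by linarith) k hx,
    fun x hx => hasDerivAt_sin_mul_jacobiPot α β hx, continuousOn_sinPotDeriv α β,
    fun x hx => (abs_jacobiPot_le α β hx).trans ?_,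
    fun x hx => (abs_sinPotDeriv_le α β hx).trans ?_,
    fun x hx => (hB k x hx).1.trans hPB, fun x hx => ?_,
    (jacobiFreq_pos (by linarith) k).le, ?_⟩
  · gcongr
  · gcongr
  · have h := (hB k x hx).2
    have hs := sin_pos_of_pos_of_lt_pi hx.1 hx.2
    have hinv : 0 < 1 / sin x := by positivity
    calc 3 * |jacobiUDeriv α β (k + 1) x| ≤ 3 * (B * ((k : ℝ) + 1 + 1 / sin x)) := by gcongr
      _ ≤ 3 * (B * (2 * (R + 1 / sin x))) := by gcongr; linarith
      _ = 6 * B * (R + 1 / sin x) := by ring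
      _ ≤ P * (R + 1 / sin x) := by gcongr; linarith
  · have h1 : jacobiFreq α β (k + 1) ≤ (1 + (α + β + 1)) * (k + 1) := by
      unfold jacobiFreq
      push_cast
      have := mul_nonneg hσ hk0
      linarith
    calc _ ≤ _ := h1
      _ ≤ (1 + (α + β + 1)) * (2 * R) := by gcongr
      _ = 2 * (1 + (α + β + 1)) * R := by ring
      _ ≤ P * R := by gcongr; linarith

/-! ### The main oscillatory estimate on (0,π). -/

namespace IsOscillating

variable {R P N M : ℝ} {u u' V G v v' W H : ℝ → ℝ}

theorem intervalIntegrable_sin_deriv_mul (hu : IsOscillating R P N u u' V G)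
    (hv : IsOscillating R P M v v' W H) (hR : 1 ≤ R) (hP : 1 ≤ P) :
    IntervalIntegrable (fun x => sin x * (u' x * v x)) MeasureTheory.volume 0 π := by
  rw [intervalIntegrable_iff_integrableOn_Ioo_of_le pi_pos.le]
  have hc : ContinuousOn (fun x => sin x * (u' x * v x)) (Ioo 0 π) := fun x hx =>
    ((hasDerivAt_sin x).continuousAt.mul ((hu.deriv_u' x hx).continuousAt.mul
      (hv.deriv_u x hx).continuousAt)).continuousWithinAt
  refine MeasureTheory.IntegrableOn.of_bound (by simp) (hc.aestronglyMeasurable measurableSet_Ioo)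
    (P * (R + 1) * P) ?_
  rw [MeasureTheory.ae_restrict_iff' measurableSet_Ioo]
  refine MeasureTheory.ae_of_all _ fun x hx => ?_
  have hs := sin_pos_of_pos_of_lt_pi hx.1 hx.2
  have h1 : |sin x * u' x| ≤ P * (R + 1) := by
    rw [abs_mul, abs_of_pos hs]
    have h := hu.bound_u' x hx
    have h0 := abs_nonneg (u' x)
    calc sin x * |u' x| ≤ sin x * (P * (R + 1 / sin x)) := by gcongr; linarith
      _ = P * (R * sin x + 1) := by field_simp
      _ ≤ P * (R * 1 + 1) := by
          have := sin_le_one x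
          gcongr
      _ = _ := by ring
  rw [norm_eq_abs, ← mul_assoc, abs_mul]
  have h2 := hv.bound_u x hx
  gcongr

theorem abs_sin_deriv_mul_le (hu : IsOscillating R P N u u' V G)
    (hv : IsOscillating R P M v v' W H) (hR : 1 ≤ R) (hP : 1 ≤ P) {x : ℝ} (hx : x ∈ Ioo 0 π)
    (hs : sin x ≤ 1 / R) : |sin x * (u' x * v x)| ≤ P ^ 2 := by
  have hsp := sin_pos_of_pos_of_lt_pi hx.1 hx.2
  have h1 : |sin x * u' x| ≤ P := by
    rw [abs_mul, abs_of_pos hsp]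
    have h := hu.bound_u' x hx
    calc sin x * |u' x| = 1 / 3 * (sin x * (3 * |u' x|)) := by ring
      _ ≤ 1 / 3 * (sin x * (P * (R + 1 / sin x))) := by gcongr
      _ = P * (1 / 3 * (R * sin x + 1)) := by field_simp
      _ ≤ P * (1 / 3 * (R * (1 / R) + 1)) := by gcongr
      _ = P * (2 / 3) := by field_simp; norm_num
      _ ≤ P := by linarith
  rw [← mul_assoc, abs_mul, sq]
  have h2 := hv.bound_u x hx
  gcongr

/-- The end intervals have length 1/R and a bounded integrand. In the middle estimate `hΔ` turns R/Δ
and R³/Δ² into 1/d and R/d², and `hdR` absorbs 1/R and 1/d into R/d². -/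
theorem abs_integral_sin_deriv_mul (hu : IsOscillating R P N u u' V G)
    (hv : IsOscillating R P M v v' W H) (hR : 1 ≤ R) (hP : 1 ≤ P) {d : ℝ} (hd : 0 < d)
    (hdR : d ≤ P * R) (hΔ : R * d ≤ P * |N ^ 2 - M ^ 2|) :
    |∫ x in (0 : ℝ)..π, sin x * (u' x * v x)| ≤ 139 * P ^ 7 * R / d ^ 2 := by
  obtain ⟨h1, h2, h3⟩ := midInterval_facts hR
  have hP0 : 0 < P := by linarith
  have hR0 : 0 < R := by linarith
  have hΔ0 : 0 < |N ^ 2 - M ^ 2| := by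
    have : 0 < P * |N ^ 2 - M ^ 2| := lt_of_lt_of_le (by positivity) hΔ
    exact pos_of_mul_pos_right this hP0.le
  have hmid := hu.abs_integral_mid hv hR hP (abs_pos.mp hΔ0)
  have hI := hu.intervalIntegrable_sin_deriv_mul hv hR hP
  have hpi := pi_pos
  have hI1 : IntervalIntegrable (fun x => sin x * (u' x * v x)) MeasureTheory.volume 0 (1 / R) :=
    hI.mono_set (by
      rw [uIcc_of_le h1.le, uIcc_of_le hpi.le]
      exact Icc_subset_Icc le_rfl (by linarith))
  have hI2 : IntervalIntegrable (fun x => sin x * (u' x * v x)) MeasureTheory.volume (1 / R)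
      (π - 1 / R) := hI.mono_set (by
      rw [uIcc_of_le h3, uIcc_of_le hpi.le]
      exact Icc_subset_Icc h1.le (by linarith))
  have hI3 : IntervalIntegrable (fun x => sin x * (u' x * v x)) MeasureTheory.volume
      (π - 1 / R) π := hI.mono_set (by
      rw [uIcc_of_le (by linarith), uIcc_of_le hpi.le]
      exact Icc_subset_Icc (by linarith) le_rfl)
  rw [← integral_add_adjacent_intervals (hI1.trans hI2) hI3,
    ← integral_add_adjacent_intervals hI1 hI2]
  have e1 : |∫ x in (0 : ℝ)..(1 / R), sin x * (u' x * v x)| ≤ P ^ 2 / R := by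
    have h := norm_integral_le_of_norm_le_const (a := 0) (b := 1 / R)
      (f := fun x => sin x * (u' x * v x)) (C := P ^ 2) (fun x hx => by
        rw [uIoc_of_le h1.le] at hx
        refine hu.abs_sin_deriv_mul_le hv hR hP ⟨hx.1, by linarith [hx.2, pi_gt_three]⟩ ?_
        exact (sin_le hx.1.le).trans hx.2)
    rw [sub_zero, abs_of_pos h1, norm_eq_abs, mul_one_div] at h
    exact h
  have e3 : |∫ x in (π - 1 / R)..π, sin x * (u' x * v x)| ≤ P ^ 2 / R := by
    have h := norm_integral_le_of_norm_le_const (a := π - 1 / R) (b := π)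
      (f := fun x => sin x * (u' x * v x)) (C := P ^ 2) (fun x hx => by
        rw [uIoc_of_le (by linarith)] at hx
        rcases hx.2.eq_or_lt with h0 | h0
        · rw [h0, sin_pi, zero_mul, norm_zero]
          positivity
        · refine hu.abs_sin_deriv_mul_le hv hR hP ⟨by linarith [hx.1, pi_gt_three], h0⟩ ?_
          rw [← sin_pi_sub]
          exact (sin_le (by linarith)).trans (by linarith [hx.1]))
    rw [sub_sub_cancel, abs_of_pos h1, norm_eq_abs, mul_one_div] at h
    exact h
  have k1 : P ^ 2 / R ≤ P ^ 4 * R / d ^ 2 := by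
    rw [div_le_div_iff₀ hR0 (by positivity)]
    calc P ^ 2 * d ^ 2 ≤ P ^ 2 * (P * R) ^ 2 := by gcongr
      _ = _ := by ring
  have k2 : 32 * P ^ 4 * R / |N ^ 2 - M ^ 2| ≤ 32 * P ^ 6 * R / d ^ 2 := by
    rw [div_le_div_iff₀ hΔ0 (by positivity)]
    calc 32 * P ^ 4 * R * d ^ 2 = 32 * P ^ 4 * d * (R * d) := by ring
      _ ≤ 32 * P ^ 4 * (P * R) * (P * |N ^ 2 - M ^ 2|) := by gcongr
      _ = _ := by ring
  have k3 : 104 * P ^ 5 * R ^ 3 / |N ^ 2 - M ^ 2| ^ 2 ≤ 104 * P ^ 7 * R / d ^ 2 := by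
    rw [div_le_div_iff₀ (by positivity) (by positivity)]
    calc 104 * P ^ 5 * R ^ 3 * d ^ 2 = 104 * P ^ 5 * R * (R * d) ^ 2 := by ring
      _ ≤ 104 * P ^ 5 * R * (P * |N ^ 2 - M ^ 2|) ^ 2 := by gcongr
      _ = _ := by ring
  have k4 : P ^ 4 * R / d ^ 2 ≤ P ^ 7 * R / d ^ 2 := by
    gcongr
    norm_num
  have k5 : 32 * P ^ 6 * R / d ^ 2 ≤ 32 * P ^ 7 * R / d ^ 2 := by
    gcongr
    norm_num
  have t1 := abs_add_le (∫ x in (0 : ℝ)..(1 / R), sin x * (u' x * v x))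
    (∫ x in (1 / R)..(π - 1 / R), sin x * (u' x * v x))
  have t2 := abs_add_le ((∫ x in (0 : ℝ)..(1 / R), sin x * (u' x * v x)) +
    ∫ x in (1 / R)..(π - 1 / R), sin x * (u' x * v x))
    (∫ x in (π - 1 / R)..π, sin x * (u' x * v x))
  have e : 139 * P ^ 7 * R / d ^ 2 = 3 * (P ^ 7 * R / d ^ 2) + 32 * P ^ 7 * R / d ^ 2 +
    104 * P ^ 7 * R / d ^ 2 := by ring
  rw [e]
  linarith

end IsOscillating

/-! ### The transplantation kernel. -/

theorem abs_integral_zero_pi_le {f : ℝ → ℝ} {A : ℝ} (hA : ∀ x ∈ Ioo 0 π, |f x| ≤ A) :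
    |∫ x in (0 : ℝ)..π, f x| ≤ A * π := by
  rw [integral_of_le pi_pos.le, MeasureTheory.integral_Ioc_eq_integral_Ioo]
  have h := MeasureTheory.norm_setIntegral_le_of_norm_le_const (μ := MeasureTheory.volume)
    (s := Ioo 0 π) (f := f) (C := A) (by simp) hA
  rw [norm_eq_abs] at h
  refine h.trans_eq ?_
  rw [MeasureTheory.measureReal_def, Real.volume_Ioo, sub_zero, ENNReal.toReal_ofReal pi_pos.le]

theorem transplantationKernel_eq {α β γ δ : ℝ} (h : -1 ≤ α + β) (h' : -1 ≤ γ + δ) (k j : ℕ) :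
    transplantationKernel α β γ δ (k + 1) (j + 1) =
      ∫ x in (0 : ℝ)..π, jacobiU γ δ (k + 1) x * jacobiU α β (j + 1) x := by
  rw [integral_of_le pi_pos.le, MeasureTheory.integral_Ioc_eq_integral_Ioo]
  refine MeasureTheory.setIntegral_congr_fun measurableSet_Ioo fun x hx => ?_
  simp only [jacobiFun_eq h j hx, jacobiFun_eq h' k hx]

theorem exists_transplantationKernel_sub_le {α β γ δ : ℝ} (hα : -1 / 2 ≤ α) (hβ : -1 / 2 ≤ β)
    (hγ : -1 / 2 ≤ γ) (hδ : -1 / 2 ≤ δ) :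
    ∃ C : ℝ, 0 < C ∧ ∀ k j : ℕ, k ≠ j → ((j : ℝ) + 1) / 2 ≤ k + 1 → (k : ℝ) + 1 ≤ 2 * (j + 1) →
      |(∫ x in (0 : ℝ)..π, jacobiU γ δ (k + 3) x * jacobiU α β (j + 1) x) -
        ∫ x in (0 : ℝ)..π, jacobiU γ δ (k + 1) x * jacobiU α β (j + 1) x| ≤
          C / |(k : ℝ) - j| ^ 2 := by
  obtain ⟨P₁, hP₁⟩ := exists_isOscillating hγ hδ
  obtain ⟨P₂, hP₂⟩ := exists_isOscillating hα hβ
  obtain ⟨c, hc0, hc⟩ := abs_jacobiU_sub_sub_le hγ hδ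
  -- The lower bound 2 compensates the half in d/2 ≤ |N - M| when `hΔ` is checked.
  set P := max 2 (max P₁ P₂) with hPdef
  have hP2 : 2 ≤ P := le_max_left _ _
  obtain ⟨bu, hu⟩ := hP₁ P ((le_max_left _ _).trans (le_max_right _ _))
  obtain ⟨bv, hv⟩ := hP₂ P ((le_max_right _ _).trans (le_max_right _ _))
  have hpi := pi_pos
  set τ := (γ + δ - α - β) / 2 with hτ
  -- The frequencies differ by (k - j) + 1 + τ, so d ≥ L forces a gap of at least d/2. For d < L the
  -- trivial bound suffices, since L²/d² > 1.
  set L := 2 * (1 + |τ|) with hL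
  have hL0 : 0 < L := by positivity
  refine ⟨2 * P ^ 2 * π * L ^ 2 + (278 * P ^ 7 + c * P * P * π), by positivity,
    fun k j hkj h1 h2 => ?_⟩
  have hk0 : (0 : ℝ) ≤ k := k.cast_nonneg
  have hj0 : (0 : ℝ) ≤ j := j.cast_nonneg
  set d := |(k : ℝ) - j| with hd
  have hd0 : 0 < d := abs_pos.mpr (sub_ne_zero.mpr (by exact_mod_cast hkj))
  have cu := continuous_jacobiU hγ hδ
  have cv := continuous_jacobiU hα hβ
  have hII : ∀ n : ℕ, IntervalIntegrable (fun x => jacobiU γ δ n x * jacobiU α β (j + 1) x)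
      MeasureTheory.volume 0 π := fun n => ((cu n).mul (cv _)).intervalIntegrable _ _
  rw [← integral_sub (hII _) (hII _)]
  rw [add_div]
  rcases lt_or_ge d L with hdL | hdL
  · have hA : ∀ x ∈ Ioo 0 π, |jacobiU γ δ (k + 3) x * jacobiU α β (j + 1) x -
        jacobiU γ δ (k + 1) x * jacobiU α β (j + 1) x| ≤ 2 * P ^ 2 := by
      intro x hx
      have a1 := bu (k + 2) x hx
      have a2 := bu k x hx
      have a3 := bv j x hx
      rw [← sub_mul, abs_mul]
      calc _ ≤ (P + P) * P := by
            gcongr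
            exact (abs_sub _ _).trans (add_le_add a1 a2)
        _ = _ := by ring
    refine (abs_integral_zero_pi_le hA).trans ?_
    have e1 : 2 * P ^ 2 * π ≤ 2 * P ^ 2 * π * L ^ 2 / d ^ 2 := by
      rw [le_div_iff₀ (by positivity)]
      gcongr
    have e2 : 0 ≤ (278 * P ^ 7 + c * P * P * π) / d ^ 2 := by positivity
    linarith
  · have hR : (1 : ℝ) ≤ (k : ℝ) + 1 := by linarith
    -- The scale is R = k + 1, and the solution used is the one of index k + 2, midway between the
    -- two functions subtracted.
    have hU := hu (k + 1) (k + 1) hR (by push_cast; linarith)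
    have hV := hv (k + 1) j hR (by linarith)
    have e : k + 1 + 1 = k + 2 := rfl
    rw [e] at hU
    have hNge := jacobiFreq_ge (α := γ) (β := δ) (by linarith) (k + 2)
    have hMge := jacobiFreq_ge (α := α) (β := β) (by linarith) (j + 1)
    push_cast at hNge hMge
    have hdk : d ≤ k + 1 := by
      rw [hd, abs_le]
      constructor <;> linarith
    have hdiff : d / 2 ≤ |jacobiFreq γ δ (k + 2) - jacobiFreq α β (j + 1)| := by
      have e1 : jacobiFreq γ δ (k + 2) - jacobiFreq α β (j + 1) = ((k : ℝ) - j) - (-(1 + τ)) := by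
        unfold jacobiFreq
        push_cast
        rw [hτ]
        ring
      have e2 := abs_sub_abs_le_abs_sub ((k : ℝ) - j) (-(1 + τ))
      rw [abs_neg] at e2
      have e3 := abs_add_le 1 τ
      rw [abs_one] at e3
      rw [e1]
      linarith
    have hΔ : ((k : ℝ) + 1) * d ≤
        P * |jacobiFreq γ δ (k + 2) ^ 2 - jacobiFreq α β (j + 1) ^ 2| := by
      rw [sq_sub_sq, abs_mul, abs_of_pos (by linarith :
        0 < jacobiFreq γ δ (k + 2) + jacobiFreq α β (j + 1))]
      calc ((k : ℝ) + 1) * d = 2 * ((k + 1) * (d / 2)) := by ring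
        _ ≤ _ := by
          gcongr <;> linarith
    have hmain := hU.abs_integral_sin_deriv_mul hV hR (by linarith) hd0
      (hdk.trans (le_mul_of_one_le_left (by linarith) (by linarith))) hΔ
    have hIs := hU.intervalIntegrable_sin_deriv_mul hV hR (by linarith)
    set N := jacobiFreq γ δ (k + 2) with hN
    have hN0 : 0 < N := by linarith
    have hrem : |(∫ x in (0 : ℝ)..π, (jacobiU γ δ (k + 3) x * jacobiU α β (j + 1) x -
        jacobiU γ δ (k + 1) x * jacobiU α β (j + 1) x)) - 2 / N *
        ∫ x in (0 : ℝ)..π, sin x * (jacobiUDeriv γ δ (k + 2) x * jacobiU α β (j + 1) x)| ≤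
        c * P * P * π / d ^ 2 := by
      rw [← intervalIntegral.integral_const_mul,
        ← integral_sub ((hII _).sub (hII _)) (hIs.const_mul _)]
      have hb : ∀ x ∈ Ioo 0 π, |jacobiU γ δ (k + 3) x * jacobiU α β (j + 1) x -
          jacobiU γ δ (k + 1) x * jacobiU α β (j + 1) x - 2 / N *
          (sin x * (jacobiUDeriv γ δ (k + 2) x * jacobiU α β (j + 1) x))| ≤
          c * P / ((k : ℝ) + 1) ^ 2 * P := by
        intro x hx
        have h := hc k x P hx (fun n => bu n x hx)
        have h' := bv j x hx
        rw [show jacobiU γ δ (k + 3) x * jacobiU α β (j + 1) x -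
          jacobiU γ δ (k + 1) x * jacobiU α β (j + 1) x - 2 / N *
          (sin x * (jacobiUDeriv γ δ (k + 2) x * jacobiU α β (j + 1) x)) =
          (jacobiU γ δ (k + 3) x - jacobiU γ δ (k + 1) x - 2 / N *
          (sin x * jacobiUDeriv γ δ (k + 2) x)) * jacobiU α β (j + 1) x by ring, abs_mul]
        gcongr
      refine (abs_integral_zero_pi_le hb).trans ?_
      calc c * P / ((k : ℝ) + 1) ^ 2 * P * π = c * P * P * π / ((k : ℝ) + 1) ^ 2 := by ring
        _ ≤ _ := by gcongr
    have hlead : |2 / N * ∫ x in (0 : ℝ)..π,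
        sin x * (jacobiUDeriv γ δ (k + 2) x * jacobiU α β (j + 1) x)| ≤ 278 * P ^ 7 / d ^ 2 := by
      rw [abs_mul, abs_of_pos (by positivity : 0 < 2 / N)]
      calc _ ≤ 2 / ((k : ℝ) + 1) * (139 * P ^ 7 * ((k : ℝ) + 1) / d ^ 2) := by
            gcongr
            linarith
        _ = _ := by field_simp; norm_num
    have e0 : 0 ≤ 2 * P ^ 2 * π * L ^ 2 / d ^ 2 := by positivity
    have e1 := abs_sub_abs_le_abs_sub (∫ x in (0 : ℝ)..π,
      (jacobiU γ δ (k + 3) x * jacobiU α β (j + 1) x -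
        jacobiU γ δ (k + 1) x * jacobiU α β (j + 1) x)) (2 / N *
        ∫ x in (0 : ℝ)..π, sin x * (jacobiUDeriv γ δ (k + 2) x * jacobiU α β (j + 1) x))
    rw [add_div]
    linarith

theorem mainTheorem5 (α β γ δ : ℝ)
    (hα : -1 / 2 ≤ α) (hβ : -1 / 2 ≤ β) (hγ : -1 / 2 ≤ γ) (hδ : -1 / 2 ≤ δ)
    (hαγ : α ≠ γ) (hβδ : β ≠ δ) :
    ∃ C : ℝ, 0 < C ∧ ∀ n m : ℕ, n ≠ m → (m : ℝ) / 2 ≤ (n : ℝ) → (n : ℝ) ≤ 2 * (m : ℝ) →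
      |transplantationKernel α β γ δ (n + 2) m - transplantationKernel α β γ δ n m|
          ≤ C / |(n : ℝ) - (m : ℝ)| ^ 2 ∧
      |transplantationKernel α β γ δ n m - transplantationKernel α β γ δ n (m + 2)|
          ≤ C / |(n : ℝ) - (m : ℝ)| ^ 2 := by
  obtain ⟨C₁, hC₁, h₁⟩ := exists_transplantationKernel_sub_le hα hβ hγ hδ
  obtain ⟨C₂, hC₂, h₂⟩ := exists_transplantationKernel_sub_le hγ hδ hα hβ
  have hab : -1 ≤ α + β := by linarith
  have hcd : -1 ≤ γ + δ := by linarith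
  refine ⟨C₁ + C₂, by positivity, fun n m hnm hmn hnm' => ?_⟩
  -- If either index were 0 the comparability condition would force n = m; hence the separate
  -- normalization at index 0 never enters.
  have hm : m ≠ 0 := by
    rintro rfl
    have : (n : ℝ) ≤ 0 := by simpa using hnm'
    exact hnm (by exact_mod_cast le_antisymm this n.cast_nonneg)
  have hn : n ≠ 0 := by
    rintro rfl
    have : (m : ℝ) ≤ 0 := by
      have : (m : ℝ) / 2 ≤ 0 := by simpa using hmn
      linarith
    exact hm (by exact_mod_cast le_antisymm this m.cast_nonneg)
  obtain ⟨k, rfl⟩ := Nat.exists_eq_succ_of_ne_zero hn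
  obtain ⟨j, rfl⟩ := Nat.exists_eq_succ_of_ne_zero hm
  have hkj : k ≠ j := fun h => hnm (by rw [h])
  simp only [Nat.succ_eq_add_one] at hmn hnm' ⊢
  push_cast at hmn hnm' ⊢
  rw [add_sub_add_right_eq_sub]
  constructor
  · have e := transplantationKernel_eq hab hcd (k + 2) j
    rw [show k + 1 + 2 = k + 2 + 1 from rfl, e, transplantationKernel_eq hab hcd k j]
    refine (h₁ k j hkj hmn hnm').trans ?_
    gcongr
    linarith
  -- The kernel is unchanged when both the parameter pairs and the indices are exchanged, so the
  -- second estimate is the first with the roles reversed.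
  · have e := transplantationKernel_eq hab hcd k (j + 2)
    rw [show j + 1 + 2 = j + 2 + 1 from rfl, e, transplantationKernel_eq hab hcd k j,
      abs_sub_comm, abs_sub_comm (k : ℝ)]
    have h := h₂ j k hkj.symm (by linarith) (by linarith)
    simp only [mul_comm (jacobiU α β _ _)] at h
    refine h.trans ?_
    gcongr
    linarith
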